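/- Let $\mathsf{C}(G)$ denote the number of connected components of a finite simple graph $G$, and call two graphs on the same vertex set edge-neighboring if there is an edge $e$ with $E_1\setminus\{e\}=E_2\setminus\{e\}$. For every $c>0$ there is a constant $C=C(c)>0$ such that for every integer $K>0$ and all $\varepsilon>0$, $\kappa>0$ there is a randomized algorithm $\mathcal{A}'$ in the adjacency-list query model (degree queries: given $v$, return $\deg(v)$; neighbor queries: given $v$ and $i$, return the $i$-th neighbor of $v$, or $\perp$ if $i>\deg(v)$; the order of the neighbors is arbitrary) with the following properties, where $\log$ is the natural logarithm. 1. (Privacy) $\mathcal{A}'$ is $\varepsilon$-edge differentially private: for all edge-neighboring graphs $G_1,G_2$ and all measurable $S\subseteq\mathbb{R}$, $\Pr[\mathcal{A}'(G_1)\in S]\le e^{\varepsilon}\Pr[\mathcal{A}'(G_2)\in S]$ (for any adjacency-list representations of $G_1$ and $G_2$). 2. (Accuracy) For every graph $G$ on $n\ge 2$ vertices, with probability at least $1-\frac{1}{n^{c}}-\frac{1}{n^{c-1}(e^{\varepsilon}-1)/K+1}$, $$\left|\mathcal{A}'(G)-\mathsf{C}(G)\right|\le \kappa n\left(\frac{8c}{\varepsilon}+\frac{1}{\log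 n}\right)+\frac{2c\log n}{\varepsilon}+\frac{1}{Kn}.$$ 3. (Queries) On every graph with $n\ge 2$ vertices, $\mathcal{A}'$ always makes at most $C\cdot\frac{\log^3 n}{\kappa^2}\cdot\max\left\{0,\log\frac{\log n}{\kappa}\right\}$ queries. -/

import Mathlib

open MeasureTheory

/-- Two graphs on the same vertex set are edge-neighboring if they agree up to one edge `e`. -/
def EdgeNeighboring {V : Type*} (G₁ G₂ : SimpleGraph V) : Prop :=
  ∃ e : Sym2 V, G₁.edgeSet \ {e} = G₂.edgeSet \ {e}

/-- An adjacency-list representation of `G`: for every vertex, its neighbors, each listed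
exactly once, in an arbitrary order. -/
structure AdjList {n : ℕ} (G : SimpleGraph (Fin n)) where
  nbrs : Fin n → List (Fin n)
  nodup : ∀ v, (nbrs v).Nodup
  mem_iff : ∀ v w, w ∈ nbrs v ↔ G.Adj v w

/-- Deterministic adaptive algorithms (decision trees) in the adjacency-list query model on the
vertex set `Fin n`, with real output. `degree v next` asks for the degree of `v`;
`neighbor v i next` asks for the neighbor of `v` at position `i` (counted from `0`) of its
adjacency list. The computation continues with `next` applied to the answer. -/
inductive QueryTree (n : ℕ) : Type where
  | output (x : ℝ) : QueryTree n
  | degree (v : Fin n) (next : ℕ → QueryTree n) : QueryTree n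
  | neighbor (v : Fin n) (i : Fin n) (next : Option (Fin n) → QueryTree n) : QueryTree n

namespace QueryTree

/-- The output on the input `L`. A neighbor query past the end of a list is answered `none`. -/
def run {n : ℕ} {G : SimpleGraph (Fin n)} (L : AdjList G) : QueryTree n → ℝ
  | output x => x
  | degree v next => run L (next (L.nbrs v).length)
  | neighbor v i next => run L (next (L.nbrs v)[(i : ℕ)]?)

/-- The number of queries made on the input `L`. -/
def queries {n : ℕ} {G : SimpleGraph (Fin n)} (L : AdjList G) : QueryTree n → ℕ
  | output _ => 0
  | degree v next => queries L (next (L.nbrs v).length) + 1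
  | neighbor v i next => queries L (next (L.nbrs v)[(i : ℕ)]?) + 1

end QueryTree

/-- A randomized algorithm in the adjacency-list query model on `n`-vertex graphs: random coins
`ω` from a probability space, and a decision tree that is executed for each outcome `ω`. -/
structure RandQueryAlg (n : ℕ) where
  Coins : Type
  mCoins : MeasurableSpace Coins
  P : Measure Coins
  isProb : IsProbabilityMeasure P
  tree : Coins → QueryTree n
  measurable_run : ∀ (G : SimpleGraph (Fin n)) (L : AdjList G),
    Measurable fun ω => (tree ω).run L

namespace RandQueryAlg

/-- The distribution of the output on the input `L`. -/
noncomputable def law {n : ℕ} (A : RandQueryAlg n) {G : SimpleGraph (Fin n)} (L : AdjList G) :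
    Measure ℝ :=
  @Measure.map _ _ A.mCoins _ (fun ω => (A.tree ω).run L) A.P

/-- `ε`-edge differential privacy: for edge-neighboring graphs, in whatever adjacency-list
representations they are given, the output distributions are within a factor `exp ε`. -/
def IsEdgeDP {n : ℕ} (A : RandQueryAlg n) (ε : ℝ) : Prop :=
  ∀ (G₁ G₂ : SimpleGraph (Fin n)), EdgeNeighboring G₁ G₂ →
    ∀ (L₁ : AdjList G₁) (L₂ : AdjList G₂) (S : Set ℝ), MeasurableSet S →
      A.law L₁ S ≤ ENNReal.ofReal (Real.exp ε) * A.law L₂ S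

end RandQueryAlg

/-- The number of connected components of a graph. -/
noncomputable def numComponents {V : Type*} (G : SimpleGraph V) : ℕ :=
  Nat.card G.ConnectedComponent

/-- The additive error `κ n (8c/ε + 1/log n) + 2 c log n / ε + 1/(K n)`. -/
noncomputable def ccError (K : ℕ) (c ε κ : ℝ) (n : ℕ) : ℝ :=
  κ * n * (8 * c / ε + 1 / Real.log n) + 2 * c * Real.log n / ε + 1 / ((K : ℝ) * n)


/-!
Write `s v` for the size of the component of `v`, so that the number of components is
`∑ v, 1 / s v`. Dropping the vertices with `2 ^ J ≤ s v` costs at most `n / 2 ^ J`. The others are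
split into levels `2 ^ j ≤ s v < 2 ^ (j + 1)`, and level `j` is estimated from `m * 4 ^ (J - j)`
uniform vertices. A search stopped at `2 ^ (j + 1)` vertices costs about `4 ^ j` queries, so all
levels cost the same, and every sample contributes at most `n / (m * 2 ^ J)`, with total variance
`n ^ 2 / (m * 4 ^ J)`.
Bernstein's inequality then needs only `m` of order `log n` when `2 ^ J` is of order `log n / κ`.

Privacy comes from Laplace noise. Changing one edge changes `1 / s v` by at most `3` in total over
all `v`, whatever the number of vertices affected, so the expected change of the estimate is at most
`3` as well. For independent bounded summands this average suffices: the densities of the sums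
convolved with Laplace noise differ by a factor close to the exponential of the expected change.

With `x = log n / κ`, the constant guess `n / 2` is accurate enough when `x < 2`, reading the whole
graph is affordable when `n < x`, and the sampled estimate is used in between.
-/

section Components

variable {V : Type*} {G G₁ G₂ : SimpleGraph V} {u v w x : V}

theorem sup_edge_eq_of_edgeSet_diff_eq (h : G₁.edgeSet \ {s(u, w)} = G₂.edgeSet \ {s(u, w)}) :
    G₁ ⊔ SimpleGraph.edge u w = G₂ ⊔ SimpleGraph.edge u w := by
  rw [← SimpleGraph.edgeSet_inj, SimpleGraph.edgeSet_sup, SimpleGraph.edgeSet_sup,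
    SimpleGraph.edgeSet_edge]
  ext e
  have he := Set.ext_iff.1 h e
  have h₁ := SimpleGraph.edgeSet_subset_compl_diagSet G₁ (a := e)
  have h₂ := SimpleGraph.edgeSet_subset_compl_diagSet G₂ (a := e)
  simp only [Set.mem_sdiff, Set.mem_singleton_iff, Set.mem_union, Set.mem_compl_iff] at *
  tauto

theorem EdgeNeighboring.exists_eq_sup_edge (h : EdgeNeighboring G₁ G₂) :
    ∃ u w, G₂ = G₁ ⊔ SimpleGraph.edge u w ∨ G₁ = G₂ ⊔ SimpleGraph.edge u w := by
  obtain ⟨⟨u, w⟩, he⟩ := h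
  have hsup := sup_edge_eq_of_edgeSet_diff_eq he
  by_cases h₁ : G₁.Adj u w
  · exact ⟨u, w, .inr (by rw [← hsup, SimpleGraph.sup_edge_of_adj _ h₁])⟩
  by_cases h₂ : G₂.Adj u w
  · exact ⟨u, w, .inl (by rw [hsup, SimpleGraph.sup_edge_of_adj _ h₂])⟩
  refine ⟨u, u, .inl ?_⟩
  rw [SimpleGraph.sup_edge_self, ← G₁.sdiff_edge h₁, ← G₂.sdiff_edge h₂, ← sup_sdiff_right_self,
    ← hsup, sup_sdiff_right_self]

theorem reachable_or_reachable_of_sup_edge (h : (G ⊔ SimpleGraph.edge u w).Reachable u v) :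
    G.Reachable u v ∨ G.Reachable w v := by
  rw [SimpleGraph.reachable_iff_reflTransGen] at h
  induction h with
  | refl => exact .inl .rfl
  | tail _ hadj ih =>
    rw [SimpleGraph.sup_adj, SimpleGraph.edge_adj] at hadj
    rcases hadj with hG | ⟨⟨-, rfl⟩ | ⟨-, rfl⟩, -⟩
    · exact ih.imp (·.trans hG.reachable) (·.trans hG.reachable)
    · exact .inr .rfl
    · exact .inl .rfl

theorem reachable_of_sup_edge (hv : ¬ (G ⊔ SimpleGraph.edge u w).Reachable u v)
    (h : (G ⊔ SimpleGraph.edge u w).Reachable v x) : G.Reachable v x := by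
  rw [SimpleGraph.reachable_iff_reflTransGen] at h
  induction h with
  | refl => exact .rfl
  | @tail a b hva hadj ih =>
    rw [← SimpleGraph.reachable_iff_reflTransGen] at hva
    rcases hadj with hG | hedge
    · exact ih.trans hG.reachable
    · refine absurd ?_ hv
      rcases ((SimpleGraph.edge_adj ..).1 hedge).1 with ⟨rfl, -⟩ | ⟨-, rfl⟩
      · exact hva.symm
      · exact (hva.trans (SimpleGraph.Adj.reachable (.inr hedge))).symm

variable [Fintype V]

open Classical in
/-- The vertex set of the connected component of `v`. -/
noncomputable def componentFinset (G : SimpleGraph V) (v : V) : Finset V :=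
  Finset.univ.filter (G.Reachable v)

/-- The number of vertices of the connected component of `v`. -/
noncomputable def componentSize (G : SimpleGraph V) (v : V) : ℕ := (componentFinset G v).card

theorem mem_componentFinset : w ∈ componentFinset G v ↔ G.Reachable v w := by
  simp [componentFinset]

theorem componentFinset_mono (h : G₁ ≤ G₂) (v : V) :
    componentFinset G₁ v ⊆ componentFinset G₂ v := fun _ hw =>
  mem_componentFinset.2 ((mem_componentFinset.1 hw).mono h)

theorem componentSize_pos (G : SimpleGraph V) (v : V) : 0 < componentSize G v :=
  Finset.card_pos.2 ⟨v, mem_componentFinset.2 .rfl⟩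

theorem componentFinset_eq_of_reachable (h : G.Reachable v w) :
    componentFinset G w = componentFinset G v := by
  ext x
  simp only [mem_componentFinset]
  exact ⟨h.trans, h.symm.trans⟩

theorem sum_componentFinset_one_div_componentSize (G : SimpleGraph V) (v : V) :
    ∑ w ∈ componentFinset G v, 1 / (componentSize G w : ℝ) = 1 := by
  have hconst : ∀ w ∈ componentFinset G v,
      1 / (componentSize G w : ℝ) = 1 / (componentSize G v : ℝ) := fun w hw => by
    rw [componentSize, componentFinset_eq_of_reachable (mem_componentFinset.1 hw), componentSize]
  have hpos : (componentSize G v : ℝ) ≠ 0 := by exact_mod_cast (componentSize_pos G v).ne'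
  rw [Finset.sum_congr rfl hconst, Finset.sum_const, nsmul_eq_mul]
  exact mul_one_div_cancel hpos

theorem numComponents_eq_sum_one_div_componentSize (G : SimpleGraph V) :
    (numComponents G : ℝ) = ∑ v, 1 / (componentSize G v : ℝ) := by
  classical
  have hfiber (c : G.ConnectedComponent) :
      ∑ v with G.connectedComponentMk v = c, 1 / (componentSize G v : ℝ) = 1 := by
    obtain ⟨v, rfl⟩ := c.exists_rep
    refine Eq.trans (Finset.sum_congr ?_ fun _ _ => rfl)
      (sum_componentFinset_one_div_componentSize G v)
    ext w
    simp only [Finset.mem_filter, Finset.mem_univ, true_and, mem_componentFinset]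
    exact SimpleGraph.ConnectedComponent.eq.trans SimpleGraph.reachable_comm
  rw [← Finset.sum_fiberwise _ G.connectedComponentMk, Finset.sum_congr rfl fun c _ => hfiber c]
  simp [numComponents, Nat.card_eq_fintype_card]

theorem numComponents_le_card (G : SimpleGraph V) : numComponents G ≤ Fintype.card V := by
  classical
  rw [numComponents, Nat.card_eq_fintype_card]
  exact Fintype.card_le_of_surjective _ Quot.mk_surjective

theorem componentSize_sup_edge (hv : v ∉ componentFinset (G ⊔ SimpleGraph.edge u w) u) :
    componentSize (G ⊔ SimpleGraph.edge u w) v = componentSize G v := by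
  rw [mem_componentFinset] at hv
  refine congrArg Finset.card
    (Finset.Subset.antisymm (fun x hx => ?_) (componentFinset_mono le_sup_left v))
  exact mem_componentFinset.2 (reachable_of_sup_edge hv (mem_componentFinset.1 hx))

theorem one_le_sum_one_div_componentSize_of_sup_edge :
    1 ≤ ∑ v ∈ componentFinset (G ⊔ SimpleGraph.edge u w) u, 1 / (componentSize G v : ℝ) := by
  refine (sum_componentFinset_one_div_componentSize G u).symm.trans_le ?_
  exact Finset.sum_le_sum_of_subset_of_nonneg (componentFinset_mono le_sup_left u)
    fun _ _ _ => by positivity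

theorem sum_one_div_componentSize_le_two_of_sup_edge :
    ∑ v ∈ componentFinset (G ⊔ SimpleGraph.edge u w) u, 1 / (componentSize G v : ℝ) ≤ 2 := by
  classical
  have hsub : componentFinset (G ⊔ SimpleGraph.edge u w) u ⊆
      componentFinset G u ∪ componentFinset G w := fun v hv => by
    rw [Finset.mem_union, mem_componentFinset, mem_componentFinset]
    exact reachable_or_reachable_of_sup_edge (mem_componentFinset.1 hv)
  have hnonneg (v : V) : 0 ≤ 1 / (componentSize G v : ℝ) := by positivity
  calc ∑ v ∈ componentFinset (G ⊔ SimpleGraph.edge u w) u, 1 / (componentSize G v : ℝ)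
      ≤ ∑ v ∈ componentFinset G u ∪ componentFinset G w, 1 / (componentSize G v : ℝ) :=
        Finset.sum_le_sum_of_subset_of_nonneg hsub fun v _ _ => hnonneg v
    _ ≤ ∑ v ∈ componentFinset G u ∪ componentFinset G w, 1 / (componentSize G v : ℝ)
        + ∑ v ∈ componentFinset G u ∩ componentFinset G w, 1 / (componentSize G v : ℝ) :=
        le_add_of_nonneg_right (Finset.sum_nonneg fun v _ => hnonneg v)
    _ = 2 := by
        rw [Finset.sum_union_inter, sum_componentFinset_one_div_componentSize,
          sum_componentFinset_one_div_componentSize]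
        norm_num

omit [Fintype V] in
theorem abs_numComponents_sub_sup_edge_le_one [Finite V] :
    |(numComponents G : ℝ) - numComponents (G ⊔ SimpleGraph.edge u w)| ≤ 1 := by
  have := Fintype.ofFinite V
  set G' := G ⊔ SimpleGraph.edge u w
  have hdiff : (numComponents G : ℝ) - numComponents G' =
      ∑ v ∈ componentFinset G' u, 1 / (componentSize G v : ℝ) - 1 := by
    refine Eq.trans ?_ (congrArg (_ - ·) (sum_componentFinset_one_div_componentSize G' u))
    rw [numComponents_eq_sum_one_div_componentSize, numComponents_eq_sum_one_div_componentSize,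
      ← Finset.sum_sub_distrib, ← Finset.sum_sub_distrib]
    refine (Finset.sum_subset (Finset.subset_univ _) fun v _ hv => ?_).symm
    rw [componentSize_sup_edge hv, sub_self]
  have hlower : 1 ≤ ∑ v ∈ componentFinset G' u, 1 / (componentSize G v : ℝ) :=
    one_le_sum_one_div_componentSize_of_sup_edge
  have hupper : ∑ v ∈ componentFinset G' u, 1 / (componentSize G v : ℝ) ≤ 2 :=
    sum_one_div_componentSize_le_two_of_sup_edge
  rw [hdiff, abs_le]
  constructor <;> linarith

omit [Fintype V] in
theorem EdgeNeighboring.abs_numComponents_sub_le_one [Finite V] (h : EdgeNeighboring G₁ G₂) :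
    |(numComponents G₁ : ℝ) - numComponents G₂| ≤ 1 := by
  obtain ⟨u, w, rfl | rfl⟩ := h.exists_eq_sup_edge
  · exact abs_numComponents_sub_sup_edge_le_one
  · exact abs_sub_comm _ _ |>.trans_le abs_numComponents_sub_sup_edge_le_one

section Sensitivity

variable {ι : Type*} {s : Finset ι} {φ : ι → ℕ → ℝ}

theorem sum_abs_componentSize_sub_sup_edge_le_three (hφ : ∀ j m, 0 ≤ φ j m)
    (hsum : ∀ m, ∑ j ∈ s, φ j m ≤ 1 / m) :
    ∑ j ∈ s, ∑ v, |φ j (componentSize G v) -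
      φ j (componentSize (G ⊔ SimpleGraph.edge u w) v)| ≤ 3 := by
  set G' := G ⊔ SimpleGraph.edge u w with hG'
  have hvertex (v : V) : ∑ j ∈ s, |φ j (componentSize G v) - φ j (componentSize G' v)| ≤
      1 / (componentSize G v : ℝ) + 1 / (componentSize G' v : ℝ) := by
    refine le_trans (Finset.sum_le_sum fun j _ => ?_)
      (Finset.sum_add_distrib.trans_le (add_le_add (hsum _) (hsum _)))
    rw [abs_le]
    constructor <;> linarith [hφ j (componentSize G v), hφ j (componentSize G' v)]
  calc ∑ j ∈ s, ∑ v, |φ j (componentSize G v) - φ j (componentSize G' v)|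
      = ∑ v, ∑ j ∈ s, |φ j (componentSize G v) - φ j (componentSize G' v)| := Finset.sum_comm
    _ = ∑ v ∈ componentFinset G' u,
          ∑ j ∈ s, |φ j (componentSize G v) - φ j (componentSize G' v)| := by
        refine (Finset.sum_subset (Finset.subset_univ _) fun v _ hv => ?_).symm
        simp [hG', componentSize_sup_edge hv]
    _ ≤ ∑ v ∈ componentFinset G' u,
          (1 / (componentSize G v : ℝ) + 1 / (componentSize G' v : ℝ)) :=
        Finset.sum_le_sum fun v _ => hvertex v
    _ ≤ 2 + 1 := by
        rw [Finset.sum_add_distrib, sum_componentFinset_one_div_componentSize]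
        exact add_le_add_left sum_one_div_componentSize_le_two_of_sup_edge 1
    _ = 3 := by norm_num

theorem EdgeNeighboring.sum_abs_componentSize_sub_le_three (h : EdgeNeighboring G₁ G₂)
    (hφ : ∀ j m, 0 ≤ φ j m) (hsum : ∀ m, ∑ j ∈ s, φ j m ≤ 1 / m) :
    ∑ j ∈ s, ∑ v, |φ j (componentSize G₁ v) - φ j (componentSize G₂ v)| ≤ 3 := by
  obtain ⟨u, w, rfl | rfl⟩ := h.exists_eq_sup_edge
  · exact sum_abs_componentSize_sub_sup_edge_le_three hφ hsum
  · simp only [abs_sub_comm (φ _ (componentSize (G₂ ⊔ _) _))]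
    exact sum_abs_componentSize_sub_sup_edge_le_three hφ hsum

end Sensitivity

end Components

section Search

variable {V : Type*} [DecidableEq V] {N : V → Finset V} {S P T : Finset V}

/-- Graph search in which `N v` is the set of vertices discovered by processing `v`: starting from
the discovered vertices `S`, of which those in `P` are already processed, process at most `fuel`
further discovered vertices, and return all discovered vertices. -/
noncomputable def search (N : V → Finset V) : ℕ → Finset V → Finset V → Finset V
  | 0, S, _ => S
  | fuel + 1, S, P =>
    if h : (S \ P).Nonempty then search N fuel (S ∪ N h.choose) (insert h.choose P) else S

theorem subset_search (fuel : ℕ) : S ⊆ search N fuel S P := by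
  induction fuel generalizing S P with
  | zero => exact subset_rfl
  | succ fuel ih =>
    unfold search
    split_ifs with h
    · exact Finset.subset_union_left.trans ih
    · exact subset_rfl

theorem search_subset (fuel : ℕ) (hS : S ⊆ T) (hT : ∀ a ∈ T, N a ⊆ T) :
    search N fuel S P ⊆ T := by
  induction fuel generalizing S P with
  | zero => exact hS
  | succ fuel ih =>
    unfold search
    split_ifs with h
    · exact ih (Finset.union_subset hS (hT _ (hS (Finset.mem_sdiff.1 h.choose_spec).1)))
    · exact hS

theorem subset_search_of_card_lt {fuel : ℕ} (hP : P ⊆ S) (hN : ∀ a ∈ P, N a ⊆ S)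
    (hcard : (search N fuel S P).card < P.card + fuel) :
    ∀ a ∈ search N fuel S P, N a ⊆ search N fuel S P := by
  induction fuel generalizing S P with
  | zero => exact absurd (Finset.card_le_card hP) hcard.not_ge
  | succ fuel ih =>
    unfold search at hcard ⊢
    split_ifs at hcard ⊢ with h
    · obtain ⟨hmem, hnot⟩ := Finset.mem_sdiff.1 h.choose_spec
      refine ih ?_ ?_ (hcard.trans_eq ?_)
      · exact Finset.insert_subset (Finset.mem_union_left _ hmem)
          (hP.trans Finset.subset_union_left)
      · exact Finset.forall_mem_insert _ _ _ |>.2 ⟨Finset.subset_union_right,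
          fun a ha => (hN a ha).trans Finset.subset_union_left⟩
      · rw [Finset.card_insert_of_notMem hnot, add_assoc, add_comm 1]
    · rw [Finset.not_nonempty_iff_eq_empty, Finset.sdiff_eq_empty_iff_subset] at h
      exact fun a ha => hN a (h ha)

end Search

section QueryTrees

variable {n : ℕ} {G : SimpleGraph (Fin n)}

namespace AdjList

variable (L : AdjList G)

theorem lt_of_getElem?_nbrs_eq_some {v w : Fin n} {i : ℕ} (h : (L.nbrs v)[i]? = some w) :
    i < n := by
  simpa using (List.getElem?_eq_some_iff.1 h).1.trans_le (L.nodup v).length_le_card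

/-- The first `k` neighbors of `v`. -/
def firstNeighbors (k : ℕ) (v : Fin n) : Finset (Fin n) := ((L.nbrs v).take k).toFinset

theorem adj_of_mem_firstNeighbors {k : ℕ} {v w : Fin n} (h : w ∈ L.firstNeighbors k v) :
    G.Adj v w :=
  (L.mem_iff v w).1 (List.mem_of_mem_take (List.mem_toFinset.1 h))

theorem mem_firstNeighbors_of_card_lt {k : ℕ} {v w : Fin n}
    (hcard : (L.firstNeighbors k v).card < k) (h : G.Adj v w) : w ∈ L.firstNeighbors k v := by
  rw [firstNeighbors, List.toFinset_card_of_nodup ((L.nodup v).sublist (List.take_sublist _ _)),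
    List.length_take] at hcard
  rw [firstNeighbors, List.mem_toFinset, List.take_of_length_le (by omega)]
  exact (L.mem_iff v w).2 h

/-- The arcs `(v, w)` such that `w` stands at position `i` of the adjacency list of `v`, for some
`(v, i)` in the list. -/
def arcsAt (l : List (Fin n × Fin n)) : List (Fin n × Fin n) :=
  l.flatMap fun p => ((L.nbrs p.1)[(p.2 : ℕ)]?).toList.map (p.1, ·)

theorem mem_arcsAt {l : List (Fin n × Fin n)} {v w : Fin n} :
    (v, w) ∈ L.arcsAt l ↔ ∃ i, (v, i) ∈ l ∧ (L.nbrs v)[(i : ℕ)]? = some w := by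
  simp only [arcsAt, List.mem_flatMap, List.mem_map, Option.mem_toList, Prod.exists, Prod.mk.injEq]
  aesop

theorem toFinset_arcsAt_take (k : ℕ) (v : Fin n) :
    ((L.arcsAt (((List.finRange n).take k).map (v, ·))).map Prod.snd).toFinset =
      L.firstNeighbors k v := by
  have htake (i : Fin n) : i ∈ (List.finRange n).take k ↔ (i : ℕ) < k := by
    simp [List.mem_take_iff_getElem, Fin.ext_iff]
  ext w
  simp only [List.mem_toFinset, List.mem_map, Prod.exists, mem_arcsAt, Prod.mk.injEq, htake,
    exists_eq_right, firstNeighbors, List.mem_iff_getElem? (l := List.take _ _), List.getElem?_take]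
  constructor
  · rintro ⟨_, _, ⟨i, hi, rfl, rfl⟩, hw⟩
    exact ⟨i, by rw [if_pos hi, hw]⟩
  · rintro ⟨i, hi⟩
    obtain ⟨hik, hw⟩ := Option.ite_none_right_eq_some.1 hi
    exact ⟨v, ⟨i, L.lt_of_getElem?_nbrs_eq_some hw⟩, ⟨_, hik, rfl, rfl⟩, hw⟩

theorem fromRel_arcsAt_product :
    SimpleGraph.fromRel (fun v w =>
      (v, w) ∈ L.arcsAt (List.finRange n ×ˢ List.finRange n)) = G := by
  have hmem (v w : Fin n) :
      (v, w) ∈ L.arcsAt (List.finRange n ×ˢ List.finRange n) ↔ G.Adj v w := by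
    rw [mem_arcsAt, ← L.mem_iff, List.mem_iff_getElem?]
    constructor
    · rintro ⟨i, -, hi⟩
      exact ⟨i, hi⟩
    · rintro ⟨i, hi⟩
      exact ⟨⟨i, L.lt_of_getElem?_nbrs_eq_some hi⟩, by simp, hi⟩
  ext v w
  simp only [SimpleGraph.fromRel_adj, hmem, G.adj_comm w v, or_self]
  exact ⟨And.right, fun h => ⟨h.ne, h⟩⟩

/-- The vertices discovered from `v` by processing at most `k` vertices, and reading at most `k`
neighbors of each. -/
noncomputable def foundFrom (k : ℕ) (v : Fin n) : Finset (Fin n) :=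
  search (L.firstNeighbors k) k {v} ∅

theorem foundFrom_subset_componentFinset (k : ℕ) (v : Fin n) :
    L.foundFrom k v ⊆ componentFinset G v := by
  refine search_subset k ?_ fun a ha w hw => ?_
  · rw [Finset.singleton_subset_iff, mem_componentFinset]
  · exact mem_componentFinset.2 ((mem_componentFinset.1 ha).trans
      (L.adj_of_mem_firstNeighbors hw).reachable)

theorem foundFrom_eq_componentFinset {k : ℕ} {v : Fin n} (hcard : (L.foundFrom k v).card < k) :
    L.foundFrom k v = componentFinset G v := by
  refine (L.foundFrom_subset_componentFinset k v).antisymm fun w hw => ?_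
  have hclosed : ∀ a ∈ L.foundFrom k v, L.firstNeighbors k a ⊆ L.foundFrom k v :=
    subset_search_of_card_lt (by simp) (by simp) (by simpa [foundFrom] using hcard)
  have hr := (SimpleGraph.reachable_iff_reflTransGen _ _).1 (mem_componentFinset.1 hw)
  clear hw
  induction hr with
  | refl => exact subset_search k (Finset.mem_singleton_self v)
  | @tail a b _ hab ih =>
    refine hclosed a ih (L.mem_firstNeighbors_of_card_lt ?_ hab)
    exact (Finset.card_le_card (hclosed a ih)).trans_lt hcard

end AdjList

namespace QueryTree

/-- Query the positions `(v, i)` of a list, and continue with the list of the arcs found there. -/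
def fetch : List (Fin n × Fin n) → (List (Fin n × Fin n) → QueryTree n) → QueryTree n
  | [], next => next []
  | p :: l, next => neighbor p.1 p.2 fun o => fetch l fun E => next (o.toList.map (p.1, ·) ++ E)

theorem run_fetch (L : AdjList G) (l : List (Fin n × Fin n))
    (next : List (Fin n × Fin n) → QueryTree n) :
    (fetch l next).run L = (next (L.arcsAt l)).run L := by
  induction l generalizing next with
  | nil => rfl
  | cons p l ih => simp only [fetch, run, ih, AdjList.arcsAt, List.flatMap_cons]

theorem queries_fetch (L : AdjList G) (l : List (Fin n × Fin n))
    (next : List (Fin n × Fin n) → QueryTree n) :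
    (fetch l next).queries L = (next (L.arcsAt l)).queries L + l.length := by
  induction l generalizing next with
  | nil => rfl
  | cons p l ih =>
    simp only [fetch, queries, ih, AdjList.arcsAt, List.flatMap_cons, List.length_cons, add_assoc]

/-- Read the whole graph, and output its number of connected components plus `x`. -/
noncomputable def exactTree (n : ℕ) (x : ℝ) : QueryTree n :=
  fetch (List.finRange n ×ˢ List.finRange n) fun E =>
    output (numComponents (SimpleGraph.fromRel fun v w => (v, w) ∈ E) + x)

theorem run_exactTree (L : AdjList G) (x : ℝ) : (exactTree n x).run L = numComponents G + x := by
  rw [exactTree, run_fetch, L.fromRel_arcsAt_product, run]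

theorem queries_exactTree (L : AdjList G) (x : ℝ) : (exactTree n x).queries L = n * n := by
  simp [exactTree, queries_fetch, queries, List.length_product]

/-- The query tree that performs the search `search (L.firstNeighbors k) fuel S P` on the input `L`,
and continues with the set of vertices found. -/
noncomputable def explore (k : ℕ) :
    ℕ → Finset (Fin n) → Finset (Fin n) → (Finset (Fin n) → QueryTree n) → QueryTree n
  | 0, S, _, next => next S
  | fuel + 1, S, P, next =>
    if h : (S \ P).Nonempty then
      fetch (((List.finRange n).take k).map (h.choose, ·)) fun E =>
        explore k fuel (S ∪ (E.map Prod.snd).toFinset) (insert h.choose P) next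
    else next S

theorem run_explore (L : AdjList G) (k fuel : ℕ) (S P : Finset (Fin n))
    (next : Finset (Fin n) → QueryTree n) :
    (explore k fuel S P next).run L = (next (search (L.firstNeighbors k) fuel S P)).run L := by
  induction fuel generalizing S P with
  | zero => rfl
  | succ fuel ih =>
    unfold explore search
    split_ifs with h
    · rw [run_fetch, ih, L.toFinset_arcsAt_take]
    · rfl

theorem queries_explore_le (L : AdjList G) (k fuel : ℕ) (S P : Finset (Fin n))
    (next : Finset (Fin n) → QueryTree n) :
    (explore k fuel S P next).queries L ≤
      (next (search (L.firstNeighbors k) fuel S P)).queries L + fuel * k := by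
  induction fuel generalizing S P with
  | zero => simp [explore, search]
  | succ fuel ih =>
    unfold explore search
    split_ifs with h
    · rw [queries_fetch, L.toFinset_arcsAt_take, List.length_map, List.length_take, add_one_mul,
        ← add_assoc]
      exact add_le_add (ih _ _) (min_le_left _ _)
    · exact Nat.le_add_right _ _

end QueryTree

end QueryTrees

section Levels

/-- The contribution `1 / m` of a vertex whose component has size `m` to the number of components,
if it is to be estimated at level `j`, that is, if `2 ^ j ≤ m < 2 ^ (j + 1)`. -/
noncomputable def levelInv (j m : ℕ) : ℝ := if Nat.log 2 m = j then 1 / (m : ℝ) else 0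

theorem levelInv_nonneg (j m : ℕ) : 0 ≤ levelInv j m := by
  unfold levelInv
  split_ifs <;> positivity

theorem one_div_le_one_div_two_pow_of_le_log {j m : ℕ} (h : j ≤ Nat.log 2 m) :
    1 / (m : ℝ) ≤ 1 / 2 ^ j := by
  rcases Nat.eq_zero_or_pos m with rfl | hm
  · simp
  · exact one_div_le_one_div_of_le (by positivity)
      (by exact_mod_cast Nat.pow_le_of_le_log hm.ne' h)

theorem levelInv_le (j m : ℕ) : levelInv j m ≤ 1 / 2 ^ j := by
  unfold levelInv
  split_ifs with h
  · exact one_div_le_one_div_two_pow_of_le_log h.ge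
  · positivity

theorem levelInv_eq_zero_of_two_pow_le {j m : ℕ} (h : 2 ^ (j + 1) ≤ m) : levelInv j m = 0 :=
  if_neg (Nat.lt_of_succ_le (Nat.le_log_of_pow_le one_lt_two h)).ne'

theorem sum_levelInv (J m : ℕ) :
    ∑ j : Fin J, levelInv j m = if Nat.log 2 m < J then 1 / (m : ℝ) else 0 := by
  rw [Fin.sum_univ_eq_sum_range (fun j => levelInv j m)]
  simp [levelInv]

theorem sum_levelInv_le (J m : ℕ) : ∑ j : Fin J, levelInv j m ≤ 1 / (m : ℝ) := by
  rw [sum_levelInv]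
  split_ifs
  · exact le_rfl
  · positivity

theorem abs_sum_levelInv_sub_le (J m : ℕ) :
    |∑ j : Fin J, levelInv j m - 1 / (m : ℝ)| ≤ 1 / 2 ^ J := by
  rw [sum_levelInv]
  split_ifs with h
  · rw [sub_self, abs_zero]
    positivity
  · rw [zero_sub, abs_neg, abs_of_nonneg (by positivity)]
    exact one_div_le_one_div_two_pow_of_le_log (not_lt.1 h)

theorem abs_sum_levelInv_sub_numComponents_le {V : Type*} [Fintype V] (G : SimpleGraph V) (J : ℕ) :
    |∑ j : Fin J, ∑ v, levelInv j (componentSize G v) - numComponents G| ≤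
      Fintype.card V / 2 ^ J := by
  rw [numComponents_eq_sum_one_div_componentSize, Finset.sum_comm, ← Finset.sum_sub_distrib]
  calc _ ≤ ∑ v, |∑ j : Fin J, levelInv j (componentSize G v) - 1 / (componentSize G v : ℝ)| :=
        Finset.abs_sum_le_sum_abs _ _
    _ ≤ ∑ _v : V, 1 / 2 ^ J := Finset.sum_le_sum fun v _ => abs_sum_levelInv_sub_le J _
    _ = Fintype.card V / 2 ^ J := by simp [div_eq_mul_inv]

variable {n : ℕ} {G : SimpleGraph (Fin n)}

theorem AdjList.levelInv_card_foundFrom (L : AdjList G) (j : ℕ) (v : Fin n) :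
    levelInv j (L.foundFrom (2 ^ (j + 1)) v).card = levelInv j (componentSize G v) := by
  rcases lt_or_ge (L.foundFrom (2 ^ (j + 1)) v).card (2 ^ (j + 1)) with h | h
  · rw [L.foundFrom_eq_componentFinset h, componentSize]
  · have hle : (L.foundFrom (2 ^ (j + 1)) v).card ≤ componentSize G v :=
      Finset.card_le_card (L.foundFrom_subset_componentFinset _ v)
    rw [levelInv_eq_zero_of_two_pow_le h, levelInv_eq_zero_of_two_pow_le (h.trans hle)]

namespace QueryTree

/-- For every sample `(v, j, a)` of the list, explore the graph from `v` far enough to evaluate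
`levelInv j` at the component size of `v`. Output the sum of these values, with weights `a`,
plus `x`. -/
noncomputable def sampleTree : List (Fin n × ℕ × ℝ) → ℝ → QueryTree n
  | [], x => output x
  | (v, j, a) :: l, x => explore (2 ^ (j + 1)) (2 ^ (j + 1)) {v} ∅ fun S =>
      sampleTree l (a * levelInv j S.card + x)

theorem run_sampleTree (L : AdjList G) (l : List (Fin n × ℕ × ℝ)) (x : ℝ) :
    (sampleTree l x).run L =
      (l.map fun p => p.2.2 * levelInv p.2.1 (componentSize G p.1)).sum + x := by
  induction l generalizing x with
  | nil => simp [sampleTree, run]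
  | cons p l ih =>
    rw [sampleTree, run_explore, ih, ← AdjList.foundFrom, L.levelInv_card_foundFrom, List.map_cons,
      List.sum_cons]
    ring

theorem queries_sampleTree_le (L : AdjList G) (l : List (Fin n × ℕ × ℝ)) (x : ℝ) :
    (sampleTree l x).queries L ≤ (l.map fun p => 4 ^ (p.2.1 + 1)).sum := by
  induction l generalizing x with
  | nil => simp [sampleTree, queries]
  | cons p l ih =>
    rw [sampleTree, List.map_cons, List.sum_cons, add_comm (4 ^ _)]
    refine (queries_explore_le L _ _ _ _ _).trans (add_le_add (ih _) (le_of_eq ?_))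
    norm_num [← mul_pow]

end QueryTree

end Levels

section Laplace

open scoped ENNReal

/-- The centered Laplace distribution of scale `b`. -/
noncomputable def laplace (b : ℝ) : Measure ℝ :=
  volume.withDensity fun z => ENNReal.ofReal (Real.exp (-|z| / b) / (2 * b))

variable {b t : ℝ}

theorem laplace_neg_preimage (b : ℝ) {S : Set ℝ} (hS : MeasurableSet S) :
    laplace b (Neg.neg ⁻¹' S) = laplace b S := by
  rw [laplace, withDensity_apply _ hS, withDensity_apply _ (measurable_neg hS),
    ← (Measure.measurePreserving_neg volume).setLIntegral_comp_preimage hS (by fun_prop)]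
  simp only [abs_neg]

theorem laplace_Ioi (hb : 0 < b) (ht : 0 ≤ t) :
    laplace b (Set.Ioi t) = ENNReal.ofReal (Real.exp (-t / b) / 2) := by
  have hneg : -1 / b < 0 := div_neg_of_neg_of_pos (by norm_num) hb
  have hdensity : Set.EqOn (fun z => ENNReal.ofReal (Real.exp (-|z| / b) / (2 * b)))
      (fun z => ENNReal.ofReal (Real.exp (-1 / b * z) / (2 * b))) (Set.Ioi t) := by
    intro z hz
    simp only [abs_of_pos (ht.trans_lt hz), div_mul_eq_mul_div, neg_one_mul]
  rw [laplace, withDensity_apply _ measurableSet_Ioi,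
    setLIntegral_congr_fun measurableSet_Ioi hdensity, ← ofReal_integral_eq_lintegral_ofReal
      ((integrableOn_exp_mul_Ioi hneg t).div_const _) (ae_of_all _ fun z => by positivity),
    integral_div, integral_exp_mul_Ioi hneg]
  congr 1
  rw [div_mul_eq_mul_div, neg_one_mul]
  field_simp

theorem laplace_Iic_neg (hb : 0 < b) (ht : 0 ≤ t) :
    laplace b (Set.Iic (-t)) = ENNReal.ofReal (Real.exp (-t / b) / 2) := by
  have hatom : laplace b {t} = 0 :=
    withDensity_absolutelyContinuous _ _ Real.volume_singleton
  rw [← laplace_neg_preimage b measurableSet_Iic, Set.neg_preimage, Set.neg_Iic, neg_neg,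
    ← Set.Ioi_union_left, measure_union (by simp) (measurableSet_singleton t), hatom, add_zero,
    laplace_Ioi hb ht]

theorem isProbabilityMeasure_laplace (hb : 0 < b) : IsProbabilityMeasure (laplace b) := by
  constructor
  rw [← Set.Iic_union_Ioi (a := -(0 : ℝ)),
    measure_union (Set.Iic_disjoint_Ioi le_rfl) measurableSet_Ioi, laplace_Iic_neg hb le_rfl,
    neg_zero, laplace_Ioi hb le_rfl, ← ENNReal.ofReal_add (by positivity) (by positivity)]
  norm_num

theorem one_sub_exp_le_laplace_real_Icc (hb : 0 < b) (ht : 0 ≤ t) :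
    1 - Real.exp (-t / b) ≤ (laplace b).real (Set.Icc (-t) t) := by
  have := isProbabilityMeasure_laplace hb
  have htails : (Set.Icc (-t) t)ᶜ ⊆ Set.Iic (-t) ∪ Set.Ioi t := by
    intro z hz
    simp only [Set.mem_compl_iff, Set.mem_Icc, not_and_or, not_le] at hz
    exact hz.imp le_of_lt id
  have hcompl : (laplace b).real (Set.Icc (-t) t)ᶜ ≤ Real.exp (-t / b) := by
    refine (measureReal_mono htails).trans ((measureReal_union_le _ _).trans_eq ?_)
    rw [measureReal_def, measureReal_def, laplace_Ioi hb ht, laplace_Iic_neg hb ht,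
      ENNReal.toReal_ofReal (by positivity), add_halves]
  rw [probReal_compl_eq_one_sub measurableSet_Icc] at hcompl
  linarith

theorem laplace_preimage_add (b x : ℝ) {S : Set ℝ} (hS : MeasurableSet S) :
    laplace b ((x + ·) ⁻¹' S) =
      ∫⁻ y in S, ENNReal.ofReal (Real.exp (-|y - x| / b) / (2 * b)) := by
  rw [laplace, withDensity_apply _ (measurable_const_add x hS),
    ← (measurePreserving_add_left volume x).setLIntegral_comp_preimage hS (by fun_prop)]
  simp only [add_sub_cancel_left]

end Laplace

section Privacy

open scoped ENNReal

variable {b q r : ℝ} {h : ℝ → ℝ≥0∞}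

/-- The functions whose logarithm is Lipschitz with constant `1 / b`. The probability that `x` plus
Laplace noise of scale `b` falls into a given set is such a function of `x`. -/
def LogLipschitz (b : ℝ) (h : ℝ → ℝ≥0∞) : Prop :=
  ∀ x y, h x ≤ ENNReal.ofReal (Real.exp (|x - y| / b)) * h y

theorem LogLipschitz.lintegral_add (hh : LogLipschitz b h) (μ : Measure ℝ) :
    LogLipschitz b fun x => ∫⁻ y, h (x + y) ∂μ := by
  intro x x'
  rw [← lintegral_const_mul' _ _ ENNReal.ofReal_ne_top]
  refine lintegral_mono fun y => ?_
  simpa only [add_sub_add_right_eq_sub] using hh (x + y) (x' + y)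

theorem logLipschitz_laplace_preimage_add (hb : 0 < b) {S : Set ℝ} (hS : MeasurableSet S) :
    LogLipschitz b fun x => laplace b ((x + ·) ⁻¹' S) := by
  intro x x'
  simp only [laplace_preimage_add b _ hS]
  rw [← lintegral_const_mul' _ _ ENNReal.ofReal_ne_top]
  refine lintegral_mono fun y => ?_
  rw [← ENNReal.ofReal_mul (by positivity), ← mul_div_assoc, ← Real.exp_add, ← add_div]
  gcongr
  linarith [abs_sub_le y x x', abs_sub_comm x x', abs_sub_le y x' x]

theorem exp_le_one_add_mul_exp (x : ℝ) : Real.exp x ≤ 1 + x * Real.exp x := by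
  have h := mul_le_mul_of_nonneg_right (Real.one_sub_le_exp_neg x) (Real.exp_nonneg x)
  rw [← Real.exp_add, neg_add_cancel, Real.exp_zero] at h
  linarith

theorem LogLipschitz.le_add_mul (hh : LogLipschitz b h) (hb : 0 < b) {x y B : ℝ}
    (hxy : |x - y| ≤ B) :
    h x ≤ h y + ENNReal.ofReal (|x - y| / b * Real.exp (B / b)) * h y := by
  have hexp : Real.exp (|x - y| / b) ≤ 1 + |x - y| / b * Real.exp (B / b) :=
    (exp_le_one_add_mul_exp _).trans (by gcongr)
  calc h x ≤ ENNReal.ofReal (1 + |x - y| / b * Real.exp (B / b)) * h y :=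
        (hh x y).trans (by gcongr)
    _ = _ := by
        rw [ENNReal.ofReal_add zero_le_one (by positivity), ENNReal.ofReal_one, add_mul, one_mul]

theorem LogLipschitz.le_mul_lintegral {Ω : Type*} [MeasurableSpace Ω] {P : Measure Ω}
    [IsProbabilityMeasure P] {Y : Ω → ℝ} {y B : ℝ} (hh : LogLipschitz b h) (hb : 0 < b)
    (hY : ∀ ω, |y - Y ω| ≤ B) :
    h y ≤ ENNReal.ofReal (Real.exp (B / b)) * ∫⁻ ω, h (Y ω) ∂P := by
  rw [← lintegral_const_mul' _ _ ENNReal.ofReal_ne_top]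
  calc h y = ∫⁻ _ω, h y ∂P := by simp
    _ ≤ _ := lintegral_mono fun ω => (hh y (Y ω)).trans (by gcongr; exact hY ω)

/-- After the addition of independent Laplace noise of scale `b`, the distributions `μ` and `ν` are
indistinguishable up to a factor `exp q`. This is stated for all log-Lipschitz test functions, not
only for the probabilities of sets, so that it is inherited by convolutions. -/
def LaplaceIndistinguishable (b q : ℝ) (μ ν : Measure ℝ) : Prop :=
  ∀ h : ℝ → ℝ≥0∞, Measurable h → LogLipschitz b h →
    ∫⁻ x, h x ∂μ ≤ ENNReal.ofReal (Real.exp q) * ∫⁻ x, h x ∂ν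

namespace LaplaceIndistinguishable

variable {μ ν μ' ν' : Measure ℝ}

theorem refl (b : ℝ) (μ : Measure ℝ) : LaplaceIndistinguishable b 0 μ μ := by
  intro h _ _
  simp

theorem mono (h : LaplaceIndistinguishable b q μ ν) (hqr : q ≤ r) :
    LaplaceIndistinguishable b r μ ν :=
  fun g hg hlip => (h g hg hlip).trans (by gcongr)

theorem conv [SFinite μ'] [SFinite ν'] (h : LaplaceIndistinguishable b q μ ν)
    (h' : LaplaceIndistinguishable b r μ' ν') :
    LaplaceIndistinguishable b (q + r) (μ ∗ μ') (ν ∗ ν') := by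
  intro g hg hlip
  have hshift (x : ℝ) : LogLipschitz b fun y => g (x + y) := fun y y' => by
    simpa only [add_sub_add_left_eq_sub] using hlip (x + y) (x + y')
  rw [Measure.lintegral_conv hg, Measure.lintegral_conv hg, add_comm q, Real.exp_add,
    ENNReal.ofReal_mul (Real.exp_nonneg r), mul_assoc]
  calc ∫⁻ x, ∫⁻ y, g (x + y) ∂μ' ∂μ
      ≤ ∫⁻ x, ENNReal.ofReal (Real.exp r) * ∫⁻ y, g (x + y) ∂ν' ∂μ :=
        lintegral_mono fun x => h' _ (by fun_prop) (hshift x)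
    _ = ENNReal.ofReal (Real.exp r) * ∫⁻ x, ∫⁻ y, g (x + y) ∂ν' ∂μ :=
        lintegral_const_mul' _ _ ENNReal.ofReal_ne_top
    _ ≤ _ := by
        gcongr
        exact h _ (Measurable.lintegral_prod_right' (f := fun p : ℝ × ℝ => g (p.1 + p.2))
          (by fun_prop)) (hlip.lintegral_add ν')

theorem conv_laplace_le (h : LaplaceIndistinguishable b q μ ν) (hb : 0 < b) {S : Set ℝ}
    (hS : MeasurableSet S) :
    (μ ∗ laplace b) S ≤ ENNReal.ofReal (Real.exp q) * (ν ∗ laplace b) S := by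
  have := isProbabilityMeasure_laplace hb
  have hadd : MeasurableSet ((fun p : ℝ × ℝ => p.1 + p.2) ⁻¹' S) := measurable_add hS
  simp only [Measure.conv, Measure.map_apply measurable_add hS, Measure.prod_apply hadd]
  exact h _ (measurable_measure_prodMk_left hadd) (logLipschitz_laplace_preimage_add hb hS)

theorem dirac (x y : ℝ) :
    LaplaceIndistinguishable b (|x - y| / b) (Measure.dirac x) (Measure.dirac y) := by
  intro h hh hlip
  rw [lintegral_dirac' _ hh, lintegral_dirac' _ hh]
  exact hlip x y

variable {Ω ι : Type*} [MeasurableSpace Ω] {P : Measure Ω} [IsProbabilityMeasure P]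

theorem map_of_mem_Icc {B : ℝ} {X Y : Ω → ℝ} (hb : 0 < b) (hX : Measurable X) (hY : Measurable Y)
    (hXB : ∀ ω, X ω ∈ Set.Icc 0 B) (hYB : ∀ ω, Y ω ∈ Set.Icc 0 B) :
    LaplaceIndistinguishable b (Real.exp (2 * B / b) / b * ∫ ω, |X ω - Y ω| ∂P)
      (P.map X) (P.map Y) := by
  intro h hh hlip
  have hdist {x y : ℝ} (hx : x ∈ Set.Icc 0 B) (hy : y ∈ Set.Icc 0 B) : |x - y| ≤ B := by
    rw [abs_le]
    constructor <;> linarith [hx.1, hx.2, hy.1, hy.2]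
  have hpoint (ω : Ω) : h (X ω) ≤ h (Y ω) +
      ENNReal.ofReal (Real.exp (2 * B / b) / b * |X ω - Y ω|) * ∫⁻ ω', h (Y ω') ∂P :=
    calc h (X ω) ≤ h (Y ω) + ENNReal.ofReal (|X ω - Y ω| / b * Real.exp (B / b)) * h (Y ω) :=
          hlip.le_add_mul hb (hdist (hXB ω) (hYB ω))
      _ ≤ h (Y ω) + ENNReal.ofReal (|X ω - Y ω| / b * Real.exp (B / b)) *
            (ENNReal.ofReal (Real.exp (B / b)) * ∫⁻ ω', h (Y ω') ∂P) := by
          gcongr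
          exact hlip.le_mul_lintegral hb fun ω' => hdist (hYB ω) (hYB ω')
      _ = _ := by
          rw [← mul_assoc, ← ENNReal.ofReal_mul (by positivity), mul_assoc, ← Real.exp_add,
            ← add_div, ← two_mul, div_mul_comm]
  have hint : Integrable (fun ω => |X ω - Y ω|) P :=
    .of_bound (by fun_prop) B (ae_of_all _ fun ω => by
      rw [Real.norm_eq_abs, abs_abs]; exact hdist (hXB ω) (hYB ω))
  rw [lintegral_map hh hX, lintegral_map hh hY]
  set T := ∫⁻ ω, h (Y ω) ∂P
  calc ∫⁻ ω, h (X ω) ∂P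
      ≤ ∫⁻ ω, h (Y ω) + ENNReal.ofReal (Real.exp (2 * B / b) / b * |X ω - Y ω|) * T ∂P :=
        lintegral_mono hpoint
    _ = T + ENNReal.ofReal (Real.exp (2 * B / b) / b * ∫ ω, |X ω - Y ω| ∂P) * T := by
        rw [lintegral_add_left (by fun_prop), lintegral_mul_const _ (by fun_prop),
          ← integral_const_mul, ofReal_integral_eq_lintegral_ofReal (hint.const_mul _)
            (ae_of_all _ fun ω => by positivity)]
    _ = ENNReal.ofReal (1 + Real.exp (2 * B / b) / b * ∫ ω, |X ω - Y ω| ∂P) * T := by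
        rw [ENNReal.ofReal_add zero_le_one (by positivity), ENNReal.ofReal_one, add_mul, one_mul]
    _ ≤ _ := by
        gcongr
        linarith [Real.add_one_le_exp (Real.exp (2 * B / b) / b * ∫ ω, |X ω - Y ω| ∂P)]

theorem map_sum {q : ι → ℝ} {X Y : ι → Ω → ℝ} (hX : ProbabilityTheory.iIndepFun X P)
    (hY : ProbabilityTheory.iIndepFun Y P) (hXm : ∀ i, Measurable (X i))
    (hYm : ∀ i, Measurable (Y i))
    (h : ∀ i, LaplaceIndistinguishable b (q i) (P.map (X i)) (P.map (Y i))) (s : Finset ι) :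
    LaplaceIndistinguishable b (∑ i ∈ s, q i) (P.map (∑ i ∈ s, X i)) (P.map (∑ i ∈ s, Y i)) := by
  induction s using Finset.cons_induction with
  | empty => simpa using refl b _
  | cons i s hi ih =>
    have hsum {Z : ι → Ω → ℝ} (hZ : ProbabilityTheory.iIndepFun Z P)
        (hZm : ∀ i, Measurable (Z i)) :
        P.map (∑ j ∈ Finset.cons i s hi, Z j) = P.map (∑ j ∈ s, Z j) ∗ P.map (Z i) := by
      rw [Finset.sum_cons, add_comm]
      exact (hZ.indepFun_finsetSum_of_notMem hZm hi).map_add_eq_map_conv_map (by fun_prop) (hZm i)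
    rw [hsum hX hXm, hsum hY hYm, Finset.sum_cons, add_comm]
    exact ih.conv (h i)

end LaplaceIndistinguishable

end Privacy

section NoisyAlg

theorem one_sub_add_le_conv_real_Icc {μ ν : Measure ℝ} [IsProbabilityMeasure μ]
    [IsProbabilityMeasure ν] {M r t δ δ' : ℝ} (hμ : 1 - δ ≤ μ.real (Set.Icc (M - r) (M + r)))
    (hν : 1 - δ' ≤ ν.real (Set.Icc (-t) t)) :
    1 - (δ + δ') ≤ (μ ∗ ν).real (Set.Icc (M - (r + t)) (M + (r + t))) := by
  set I := Set.Icc (M - r) (M + r)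
  set I' := Set.Icc (-t) t
  have hsub : I ×ˢ I' ⊆
      (fun p : ℝ × ℝ => p.1 + p.2) ⁻¹' Set.Icc (M - (r + t)) (M + (r + t)) := by
    rintro ⟨x, y⟩ ⟨⟨hx₁, hx₂⟩, hy₁, hy₂⟩
    constructor <;> dsimp only at * <;> linarith
  calc 1 - (δ + δ') ≤ μ.real I * ν.real I' := by
        nlinarith [measureReal_le_one (μ := μ) (s := I), measureReal_le_one (μ := ν) (s := I')]
    _ = (μ.prod ν).real (I ×ˢ I') := (measureReal_prod_prod _ _).symm
    _ ≤ (μ.prod ν).real _ := measureReal_mono hsub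
    _ = _ := by rw [Measure.conv, map_measureReal_apply (by fun_prop) measurableSet_Icc]

namespace RandQueryAlg

variable {n : ℕ}

/-- On every input, the output of `A` differs from the number of connected components by at most `E`
with probability at least `1 - δ`. -/
def ApproximatesNumComponents (A : RandQueryAlg n) (E δ : ℝ) : Prop :=
  ∀ (G : SimpleGraph (Fin n)) (L : AdjList G),
    1 - δ ≤ (A.law L).real (Set.Icc ((numComponents G : ℝ) - E) ((numComponents G : ℝ) + E))

/-- On every input and for every outcome of the coins, `A` makes at most `q` queries. -/
def MakesAtMostQueries (A : RandQueryAlg n) (q : ℝ) : Prop :=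
  ∀ (G : SimpleGraph (Fin n)) (L : AdjList G) (ω : A.Coins), ((A.tree ω).queries L : ℝ) ≤ q

theorem isFiniteMeasure_law (A : RandQueryAlg n) {G : SimpleGraph (Fin n)} (L : AdjList G) :
    IsFiniteMeasure (A.law L) := by
  let _ := A.mCoins
  have := A.isProb
  unfold law
  infer_instance

theorem ApproximatesNumComponents.mono {A : RandQueryAlg n} {E E' δ δ' : ℝ}
    (hA : A.ApproximatesNumComponents E δ) (hE : E ≤ E') (hδ : δ ≤ δ') :
    A.ApproximatesNumComponents E' δ' := by
  intro G L
  have := A.isFiniteMeasure_law L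
  exact (sub_le_sub_left hδ 1).trans ((hA G L).trans
    (measureReal_mono (Set.Icc_subset_Icc (by linarith) (by linarith))))

theorem MakesAtMostQueries.mono {A : RandQueryAlg n} {q q' : ℝ} (hA : A.MakesAtMostQueries q)
    (hq : q ≤ q') : A.MakesAtMostQueries q' :=
  fun G L ω => (hA G L ω).trans hq

variable {Ω : Type} [MeasurableSpace Ω] (P : Measure Ω) [IsProbabilityMeasure P] {b : ℝ}
  (hb : 0 < b) {tree : Ω → ℝ → QueryTree n} {val : SimpleGraph (Fin n) → Ω → ℝ}
  (hval : ∀ G, Measurable (val G))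
  (hrun : ∀ (G : SimpleGraph (Fin n)) (L : AdjList G) ω z, (tree ω z).run L = val G ω + z)

/-- The algorithm that evaluates the statistic `val` for random coins `ω` distributed according to
`P`, and adds independent Laplace noise of scale `b`. -/
noncomputable def addLaplace : RandQueryAlg n where
  Coins := Ω × ℝ
  mCoins := inferInstance
  P := P.prod (laplace b)
  isProb := have := isProbabilityMeasure_laplace hb; inferInstance
  tree p := tree p.1 p.2
  measurable_run G L := by
    simp only [hrun]
    have := hval G
    fun_prop

theorem law_addLaplace {G : SimpleGraph (Fin n)} (L : AdjList G) :
    (addLaplace P hb hval hrun).law L = P.map (val G) ∗ laplace b := by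
  have := isProbabilityMeasure_laplace hb
  have := hval G
  conv_rhs => rw [Measure.conv, ← Measure.map_id (μ := laplace b),
    Measure.map_prod_map _ _ this measurable_id, Measure.map_map (by fun_prop) (by fun_prop)]
  simp only [law, addLaplace, hrun]
  rfl

theorem isEdgeDP_addLaplace {ε : ℝ}
    (h : ∀ G₁ G₂, EdgeNeighboring G₁ G₂ →
      LaplaceIndistinguishable b ε (P.map (val G₁)) (P.map (val G₂))) :
    (addLaplace P hb hval hrun).IsEdgeDP ε := by
  intro G₁ G₂ hG L₁ L₂ S hS
  rw [law_addLaplace, law_addLaplace]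
  exact (h G₁ G₂ hG).conv_laplace_le hb hS

theorem approximatesNumComponents_addLaplace {r t δ : ℝ} (ht : 0 ≤ t)
    (h : ∀ G, P.real {ω | r < |val G ω - numComponents G|} ≤ δ) :
    (addLaplace P hb hval hrun).ApproximatesNumComponents (r + t) (δ + Real.exp (-t / b)) := by
  intro G L
  have := isProbabilityMeasure_laplace hb
  have := Measure.isProbabilityMeasure_map (μ := P) (hval G).aemeasurable
  rw [law_addLaplace]
  refine one_sub_add_le_conv_real_Icc ?_ (one_sub_exp_le_laplace_real_Icc hb ht)
  have hcompl : val G ⁻¹' Set.Icc ((numComponents G : ℝ) - r) (numComponents G + r) =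
      {ω | r < |val G ω - numComponents G|}ᶜ := by
    ext ω
    simp only [Set.mem_preimage, Set.mem_Icc, Set.mem_compl_iff, Set.mem_ofPred_eq, not_lt, abs_le]
    constructor <;> rintro ⟨h₁, h₂⟩ <;> constructor <;> linarith
  rw [map_measureReal_apply (hval G) measurableSet_Icc, hcompl, probReal_compl_eq_one_sub]
  · linarith [h G]
  · exact measurableSet_lt measurable_const (((hval G).sub_const _).abs)

theorem exists_isEdgeDP_of_deterministic {ε t : ℝ} {q : ℕ} (hε : 0 < ε) (ht : 0 ≤ t)
    {tree : ℝ → QueryTree n} {val : SimpleGraph (Fin n) → ℝ}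
    (hrun : ∀ (G : SimpleGraph (Fin n)) (L : AdjList G) z, (tree z).run L = val G + z)
    (hqueries : ∀ (G : SimpleGraph (Fin n)) (L : AdjList G) z, (tree z).queries L ≤ q)
    (hval : ∀ G₁ G₂, EdgeNeighboring G₁ G₂ → |val G₁ - val G₂| ≤ 1) {r : ℝ}
    (hr : ∀ G, |val G - numComponents G| ≤ r) :
    ∃ A : RandQueryAlg n, A.IsEdgeDP ε ∧
      A.ApproximatesNumComponents (r + t) (Real.exp (-(ε * t))) ∧ A.MakesAtMostQueries q := by
  refine ⟨addLaplace (Measure.dirac ()) (inv_pos.2 hε) (val := fun G _ => val G)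
    (fun G => measurable_const) (fun G L _ z => hrun G L z), ?_, ?_, fun G L ω => ?_⟩
  · refine isEdgeDP_addLaplace _ _ _ _ fun G₁ G₂ h => ?_
    rw [Measure.map_const, Measure.map_const]
    simp only [measure_univ, one_smul]
    refine (LaplaceIndistinguishable.dirac _ _).mono ?_
    rw [div_inv_eq_mul]
    exact mul_le_of_le_one_left hε.le (hval G₁ G₂ h)
  · refine (approximatesNumComponents_addLaplace _ _ _ _ ht (r := r) (δ := 0) fun G => ?_).mono
      le_rfl (le_of_eq ?_)
    · simp [(hr G).not_gt]
    · rw [zero_add, div_inv_eq_mul, neg_mul, mul_comm]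
  · exact_mod_cast hqueries G L _

end RandQueryAlg

end NoisyAlg

section Concentration

open ProbabilityTheory

variable {Ω ι : Type*} [MeasurableSpace Ω] {P : Measure Ω} [IsProbabilityMeasure P] {B l r : ℝ}

theorem mgf_le_exp_of_abs_le {X : Ω → ℝ} (hX : Measurable X) (hB : ∀ ω, |X ω| ≤ B)
    (hl : |l| * B ≤ 1) : mgf X P l ≤ Real.exp (l * P[X] + l ^ 2 * P[X ^ 2]) := by
  have hint : Integrable X P := .of_bound hX.aestronglyMeasurable B (ae_of_all _ hB)
  have hint_sq : Integrable (X ^ 2) P := .of_bound (hX.pow_const 2).aestronglyMeasurable (B ^ 2)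
    (ae_of_all _ fun ω => by
      rw [Pi.pow_apply, norm_pow]
      exact pow_le_pow_left₀ (norm_nonneg _) (hB ω) 2)
  have hlX (ω : Ω) : |l * X ω| ≤ 1 := by
    rw [abs_mul]
    exact (mul_le_mul_of_nonneg_left (hB ω) (abs_nonneg l)).trans hl
  have hexp (ω : Ω) : Real.exp (l * X ω) ≤ 1 + l * X ω + l ^ 2 * (X ^ 2) ω := by
    have h := (le_abs_self _).trans (Real.abs_exp_sub_one_sub_id_le (hlX ω))
    rw [mul_pow] at h
    rw [Pi.pow_apply]
    linarith
  have hint_lin : Integrable (fun ω => 1 + l * X ω) P := (integrable_const 1).add (hint.const_mul l)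
  calc mgf X P l ≤ ∫ ω, 1 + l * X ω + l ^ 2 * (X ^ 2) ω ∂P :=
        integral_mono_of_nonneg (ae_of_all _ fun ω => by positivity)
          (hint_lin.add (hint_sq.const_mul _)) (ae_of_all _ hexp)
    _ = l * P[X] + l ^ 2 * P[X ^ 2] + 1 := by
        rw [integral_add hint_lin (hint_sq.const_mul _),
          integral_add (integrable_const 1) (hint.const_mul l), integral_const_mul,
          integral_const_mul, integral_const, probReal_univ, one_smul]
        ring
    _ ≤ _ := Real.add_one_le_exp _

variable {X : ι → Ω → ℝ}

theorem measureReal_sum_sub_integral_ge_le (hX : iIndepFun X P) (hm : ∀ i, Measurable (X i))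
    (hB : ∀ i ω, |X i ω| ≤ B) (hl0 : 0 ≤ l) (hl : l * B ≤ 1) (s : Finset ι) (r : ℝ) :
    P.real {ω | r ≤ ∑ i ∈ s, X i ω - ∑ i ∈ s, P[X i]} ≤
      Real.exp (-(l * r) + l ^ 2 * ∑ i ∈ s, P[X i ^ 2]) := by
  have hint : Integrable (fun ω => Real.exp (l * (∑ i ∈ s, X i) ω)) P :=
    hX.integrable_exp_mul_sum hm fun i _ =>
      .of_bound (by fun_prop) (Real.exp 1) (ae_of_all _ fun ω => by
        rw [Real.norm_eq_abs, Real.abs_exp, Real.exp_le_exp]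
        exact (mul_le_mul_of_nonneg_left ((le_abs_self _).trans (hB i ω)) hl0).trans hl)
  calc P.real {ω | r ≤ ∑ i ∈ s, X i ω - ∑ i ∈ s, P[X i]}
      = P.real {ω | r + ∑ i ∈ s, P[X i] ≤ (∑ i ∈ s, X i) ω} := by
        simp only [le_sub_iff_add_le, Finset.sum_apply]
    _ ≤ Real.exp (-l * (r + ∑ i ∈ s, P[X i])) * ∏ i ∈ s, mgf (X i) P l := by
        rw [← hX.mgf_sum hm]
        exact measure_ge_le_exp_mul_mgf _ hl0 hint
    _ ≤ Real.exp (-l * (r + ∑ i ∈ s, P[X i])) *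
          ∏ i ∈ s, Real.exp (l * P[X i] + l ^ 2 * P[X i ^ 2]) := by
        gcongr with i
        · exact fun _ _ => mgf_nonneg
        · exact mgf_le_exp_of_abs_le (hm i) (hB i) (by rwa [abs_of_nonneg hl0])
    _ = _ := by
        rw [← Real.exp_sum, ← Real.exp_add, Finset.sum_add_distrib, ← Finset.mul_sum,
          ← Finset.mul_sum]
        ring_nf

theorem measureReal_abs_sum_sub_integral_ge_le (hX : iIndepFun X P) (hm : ∀ i, Measurable (X i))
    (hB : ∀ i ω, |X i ω| ≤ B) (hl0 : 0 ≤ l) (hl : l * B ≤ 1) (s : Finset ι) (r : ℝ) :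
    P.real {ω | r ≤ |∑ i ∈ s, X i ω - ∑ i ∈ s, P[X i]|} ≤
      2 * Real.exp (-(l * r) + l ^ 2 * ∑ i ∈ s, P[X i ^ 2]) := by
  have hneg := measureReal_sum_sub_integral_ge_le (X := fun i => -X i)
    (hX.comp (fun _ => Neg.neg) fun _ => measurable_neg) (fun i => (hm i).neg)
    (fun i ω => by simpa only [Pi.neg_apply, abs_neg] using hB i ω) hl0 hl s r
  simp only [Pi.neg_apply, neg_sq, integral_neg, Finset.sum_neg_distrib, neg_sub_neg] at hneg
  have hsub : {ω | r ≤ |∑ i ∈ s, X i ω - ∑ i ∈ s, P[X i]|} ⊆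
      {ω | r ≤ ∑ i ∈ s, X i ω - ∑ i ∈ s, P[X i]} ∪
        {ω | r ≤ ∑ i ∈ s, P[X i] - ∑ i ∈ s, X i ω} := fun ω hω => by
    simpa only [Set.mem_union, Set.mem_ofPred_eq, le_abs, neg_sub] using hω
  refine (measureReal_mono hsub).trans ((measureReal_union_le _ _).trans ?_)
  rw [two_mul]
  exact add_le_add (measureReal_sum_sub_integral_ge_le hX hm hB hl0 hl s r) hneg

end Concentration

section LevelSampling

open ProbabilityTheory

theorem sum_four_pow_mul_levelInv_sq_le_one (J m : ℕ) :
    ∑ j : Fin J, 4 ^ (j : ℕ) * levelInv j m ^ 2 ≤ 1 := by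
  have hterm (j : ℕ) : 4 ^ j * levelInv j m ^ 2 ≤ if Nat.log 2 m = j then 1 else 0 := by
    split_ifs with h
    · calc (4 : ℝ) ^ j * levelInv j m ^ 2 ≤ 4 ^ j * (1 / 2 ^ j) ^ 2 := by
            gcongr
            · exact levelInv_nonneg j m
            · exact levelInv_le j m
        _ = 1 := by rw [div_pow, one_pow, ← pow_mul, mul_comm j, pow_mul]; norm_num
    · simp [levelInv, h]
  calc ∑ j : Fin J, (4 : ℝ) ^ (j : ℕ) * levelInv j m ^ 2
      ≤ ∑ j : Fin J, if Nat.log 2 m = j then 1 else 0 := Finset.sum_le_sum fun j _ => hterm j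
    _ ≤ 1 := by
        rw [Fin.sum_univ_eq_sum_range (fun j => if Nat.log 2 m = j then (1 : ℝ) else 0),
          Finset.sum_ite_eq]
        split_ifs <;> norm_num

theorem integral_uniformOfFintype {V : Type*} [Fintype V] [Nonempty V] [MeasurableSpace V]
    [MeasurableSingletonClass V] (f : V → ℝ) :
    ∫ v, f v ∂(PMF.uniformOfFintype V).toMeasure = (∑ v, f v) / Fintype.card V := by
  simp only [PMF.integral_eq_sum, PMF.uniformOfFintype_apply, ENNReal.toReal_inv,
    ENNReal.toReal_natCast, smul_eq_mul, inv_mul_eq_div, Finset.sum_div]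

/-- The samples: `m * 4 ^ (J - j)` of them at level `j < J`. -/
abbrev LevelSample (J m : ℕ) : Type := Σ j : Fin J, Fin (m * 4 ^ (J - j))

/-- What a sampled vertex with component size `k` contributes to the estimate at level `j`: the
factor in front makes the estimate of the total of `levelInv j` over the `n` vertices unbiased. -/
noncomputable def levelValue (n J m j k : ℕ) : ℝ := n / (m * 4 ^ (J - j)) * levelInv j k

/-- The distribution of independent uniform vertices, one for every sample. -/
noncomputable def levelCoins (n J m : ℕ) [NeZero n] : Measure (LevelSample J m → Fin n) :=
  Measure.pi fun _ => (PMF.uniformOfFintype (Fin n)).toMeasure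

/-- The estimate of the number of connected components from the sampled vertices `ω`. -/
noncomputable def levelEstimate {n : ℕ} (J m : ℕ) (G : SimpleGraph (Fin n))
    (ω : LevelSample J m → Fin n) : ℝ :=
  ∑ i, levelValue n J m i.1 (componentSize G (ω i))

variable {n J m : ℕ}

theorem levelValue_mem_Icc (hm : 0 < m) {j : ℕ} (hj : j ≤ J) (k : ℕ) :
    levelValue n J m j k ∈ Set.Icc 0 (n / (m * 2 ^ J) : ℝ) := by
  have hk := levelInv_nonneg j k
  refine ⟨by unfold levelValue; positivity, ?_⟩
  calc levelValue n J m j k ≤ n / (m * 2 ^ (J - j)) * (1 / 2 ^ j) := by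
        unfold levelValue
        gcongr
        · norm_num
        · exact levelInv_le j k
    _ = n / (m * 2 ^ J) := by
        rw [div_mul_div_comm, mul_one, mul_assoc, ← pow_add, Nat.sub_add_cancel hj]

instance [NeZero n] : IsProbabilityMeasure (levelCoins n J m) := by
  unfold levelCoins
  infer_instance

section

variable [NeZero n]

theorem iIndepFun_levelCoins (g : LevelSample J m → Fin n → ℝ) :
    iIndepFun (fun i ω => g i (ω i)) (levelCoins n J m) :=
  iIndepFun_pi fun _ => (measurable_of_finite _).aemeasurable

theorem sum_integral_levelCoins (g : ℕ → Fin n → ℝ) :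
    ∑ i : LevelSample J m, ∫ ω, g i.1 (ω i) ∂levelCoins n J m =
      ∑ j : Fin J, ∑ v, (m * 4 ^ (J - j) / n : ℝ) * g j v := by
  have hint (i : LevelSample J m) :
      ∫ ω, g i.1 (ω i) ∂levelCoins n J m = (∑ v, g i.1 v) / n := by
    rw [levelCoins, integral_comp_eval (measurable_of_finite _).aestronglyMeasurable,
      integral_uniformOfFintype, Fintype.card_fin]
  simp only [hint, Fintype.sum_sigma, Finset.sum_const, Finset.card_univ, Fintype.card_fin,
    nsmul_eq_mul, Nat.cast_mul, Nat.cast_pow, Nat.cast_ofNat, ← Finset.mul_sum]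
  exact Finset.sum_congr rfl fun j _ => by ring

theorem mul_levelValue (hm : 0 < m) (j k : ℕ) :
    (m * 4 ^ (J - j) / n : ℝ) * levelValue n J m j k = levelInv j k := by
  have hn : (n : ℝ) ≠ 0 := NeZero.ne _
  have hm' : (m : ℝ) ≠ 0 := by positivity
  rw [levelValue]
  field_simp

variable (G : SimpleGraph (Fin n))

theorem sum_integral_levelValue (hm : 0 < m) :
    ∑ i : LevelSample J m, ∫ ω, levelValue n J m i.1 (componentSize G (ω i)) ∂levelCoins n J m =
      ∑ j : Fin J, ∑ v, levelInv j (componentSize G v) := by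
  rw [sum_integral_levelCoins fun j v => levelValue n J m j (componentSize G v)]
  simp only [mul_levelValue hm]

theorem sum_integral_levelValue_sq_le (hm : 0 < m) :
    ∑ i : LevelSample J m,
        ∫ ω, levelValue n J m i.1 (componentSize G (ω i)) ^ 2 ∂levelCoins n J m ≤
      n ^ 2 / (m * 4 ^ J) := by
  have hfactor (j : Fin J) (k : ℕ) : (m * 4 ^ (J - j) / n : ℝ) * levelValue n J m j k ^ 2 =
      n / (m * 4 ^ J) * (4 ^ (j : ℕ) * levelInv j k ^ 2) := by
    have h4 : (4 : ℝ) ^ J = 4 ^ (J - j) * 4 ^ (j : ℕ) := by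
      rw [← pow_add, Nat.sub_add_cancel j.2.le]
    rw [pow_two, ← mul_assoc, mul_levelValue hm, levelValue, h4]
    field_simp
  rw [sum_integral_levelCoins fun j v => levelValue n J m j (componentSize G v) ^ 2]
  simp only [hfactor]
  rw [Finset.sum_comm]
  simp only [← Finset.mul_sum]
  calc _ ≤ n / (m * 4 ^ J) * ∑ _v : Fin n, (1 : ℝ) := by
        gcongr with v
        exact sum_four_pow_mul_levelInv_sq_le_one J _
    _ = _ := by
        rw [Finset.sum_const, Finset.card_univ, Fintype.card_fin, nsmul_one]
        ring

theorem EdgeNeighboring.sum_integral_abs_levelValue_sub_le_three {G₁ G₂ : SimpleGraph (Fin n)}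
    (h : EdgeNeighboring G₁ G₂) (hm : 0 < m) :
    ∑ i : LevelSample J m, ∫ ω, |levelValue n J m i.1 (componentSize G₁ (ω i)) -
      levelValue n J m i.1 (componentSize G₂ (ω i))| ∂levelCoins n J m ≤ 3 := by
  rw [sum_integral_levelCoins fun j v =>
    |levelValue n J m j (componentSize G₁ v) - levelValue n J m j (componentSize G₂ v)|]
  have habs (j k k' : ℕ) :
      (m * 4 ^ (J - j) / n : ℝ) * |levelValue n J m j k - levelValue n J m j k'| =
        |levelInv j k - levelInv j k'| := by
    rw [← mul_levelValue (n := n) (J := J) hm, ← mul_levelValue (n := n) (J := J) hm j k',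
      ← mul_sub, abs_mul, abs_of_nonneg (by positivity : (0 : ℝ) ≤ m * 4 ^ (J - j) / n)]
  simp only [habs]
  exact h.sum_abs_componentSize_sub_le_three (φ := fun (j : Fin J) k => levelInv j k)
    (fun j k => levelInv_nonneg j k) (sum_levelInv_le J)

theorem EdgeNeighboring.laplaceIndistinguishable_levelEstimate {G₁ G₂ : SimpleGraph (Fin n)}
    (h : EdgeNeighboring G₁ G₂) (hm : 0 < m) {b : ℝ} (hb : 0 < b) :
    LaplaceIndistinguishable b (Real.exp (2 * (n / (m * 2 ^ J)) / b) / b * 3)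
      ((levelCoins n J m).map (levelEstimate J m G₁))
      ((levelCoins n J m).map (levelEstimate J m G₂)) := by
  have hest (G : SimpleGraph (Fin n)) : levelEstimate J m G =
      ∑ i, fun ω => levelValue n J m i.1 (componentSize G (ω i)) := by
    ext ω
    rw [levelEstimate, Finset.sum_apply]
  have hbound (G : SimpleGraph (Fin n)) (i : LevelSample J m) (ω : LevelSample J m → Fin n) :
      levelValue n J m i.1 (componentSize G (ω i)) ∈ Set.Icc 0 (n / (m * 2 ^ J) : ℝ) :=
    levelValue_mem_Icc hm i.1.2.le _
  rw [hest, hest]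
  refine (LaplaceIndistinguishable.map_sum
    (iIndepFun_levelCoins fun i v => levelValue n J m i.1 (componentSize G₁ v))
    (iIndepFun_levelCoins fun i v => levelValue n J m i.1 (componentSize G₂ v))
    (fun _ => measurable_of_finite _) (fun _ => measurable_of_finite _)
    (fun i => LaplaceIndistinguishable.map_of_mem_Icc hb (measurable_of_finite _)
      (measurable_of_finite _) (hbound G₁ i) (hbound G₂ i)) Finset.univ).mono ?_
  rw [← Finset.mul_sum]
  gcongr
  exact h.sum_integral_abs_levelValue_sub_le_three hm

theorem measureReal_levelEstimate_sub_numComponents_gt_le (hm : 0 < m) {l : ℝ} (hl0 : 0 ≤ l)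
    (hl : l * (n / (m * 2 ^ J)) ≤ 1) (r : ℝ) :
    (levelCoins n J m).real {ω | n / 2 ^ J + r < |levelEstimate J m G ω - numComponents G|} ≤
      2 * Real.exp (-(l * r) + l ^ 2 * (n ^ 2 / (m * 4 ^ J))) := by
  have hbias := abs_sum_levelInv_sub_numComponents_le G J
  rw [Fintype.card_fin, ← sum_integral_levelValue G hm] at hbias
  have htail := measureReal_abs_sum_sub_integral_ge_le
    (iIndepFun_levelCoins fun (i : LevelSample J m) v => levelValue n J m i.1 (componentSize G v))
    (fun _ => measurable_of_finite _) (B := n / (m * 2 ^ J)) (fun i ω => ?_) hl0 hl Finset.univ r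
  · refine (measureReal_mono fun ω hω => ?_).trans (htail.trans ?_)
    · have hω' : n / 2 ^ J + r < |levelEstimate J m G ω - numComponents G| := hω
      rw [levelEstimate] at hω'
      rw [Set.mem_ofPred_eq]
      linarith [abs_sub_le (∑ i, levelValue n J m i.1 (componentSize G (ω i)))
        (∑ i : LevelSample J m, ∫ ω, levelValue n J m i.1 (componentSize G (ω i)) ∂levelCoins n J m)
        (numComponents G)]
    · gcongr
      exact sum_integral_levelValue_sq_le G hm
  · have hi := levelValue_mem_Icc (n := n) hm i.1.2.le (componentSize G (ω i))
    rw [abs_of_nonneg hi.1]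
    exact hi.2

end

end LevelSampling

section LevelTree

variable {n J m : ℕ}

/-- The query tree that computes `levelEstimate J m G ω + z`. -/
noncomputable def levelTree (n J m : ℕ) (ω : LevelSample J m → Fin n) (z : ℝ) : QueryTree n :=
  QueryTree.sampleTree
    ((Finset.univ : Finset (LevelSample J m)).toList.map fun i =>
      (ω i, i.1, n / (m * 4 ^ (J - i.1)))) z

theorem run_levelTree {G : SimpleGraph (Fin n)} (L : AdjList G) (ω : LevelSample J m → Fin n)
    (z : ℝ) : (levelTree n J m ω z).run L = levelEstimate J m G ω + z := by
  rw [levelTree, QueryTree.run_sampleTree, List.map_map, Finset.sum_map_toList]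
  rfl

theorem queries_levelTree_le {G : SimpleGraph (Fin n)} (L : AdjList G)
    (ω : LevelSample J m → Fin n) (z : ℝ) :
    (levelTree n J m ω z).queries L ≤ J * (m * 4 ^ (J + 1)) := by
  refine (QueryTree.queries_sampleTree_le L _ z).trans_eq ?_
  rw [List.map_map, Finset.sum_map_toList, Fintype.sum_sigma]
  have hlevel (j : Fin J) : m * 4 ^ (J - j) * 4 ^ ((j : ℕ) + 1) = m * 4 ^ (J + 1) := by
    rw [mul_assoc, ← pow_add, ← add_assoc, Nat.sub_add_cancel j.2.le]
  simp [hlevel]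

theorem exists_isEdgeDP_of_levels [NeZero n] (hm : 0 < m) {b ε l r t : ℝ} (hb : 0 < b)
    (hε : Real.exp (2 * (n / (m * 2 ^ J)) / b) / b * 3 ≤ ε) (hl0 : 0 ≤ l)
    (hl : l * (n / (m * 2 ^ J)) ≤ 1) (ht : 0 ≤ t) :
    ∃ A : RandQueryAlg n, A.IsEdgeDP ε ∧
      A.ApproximatesNumComponents (n / 2 ^ J + r + t)
        (2 * Real.exp (-(l * r) + l ^ 2 * (n ^ 2 / (m * 4 ^ J))) + Real.exp (-t / b)) ∧
      A.MakesAtMostQueries (J * (m * 4 ^ (J + 1))) := by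
  refine ⟨RandQueryAlg.addLaplace (levelCoins n J m) hb (tree := levelTree n J m)
    (fun G => measurable_of_finite (levelEstimate J m G)) fun G L => run_levelTree L, ?_, ?_,
    fun G L ω => by exact_mod_cast queries_levelTree_le L ω.1 ω.2⟩
  · exact RandQueryAlg.isEdgeDP_addLaplace _ _ _ _ fun G₁ G₂ h =>
      (h.laplaceIndistinguishable_levelEstimate hm hb).mono hε
  · exact RandQueryAlg.approximatesNumComponents_addLaplace _ _ _ _ ht fun G =>
      measureReal_levelEstimate_sub_numComponents_gt_le G hm hl0 hl r

end LevelTree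

section Parameters

theorem exp_two_mul_div_div_mul_three_le {b B ε : ℝ} (hε : 0 < ε) (hb : 4 / ε ≤ b)
    (hB : 8 * B ≤ b) : Real.exp (2 * B / b) / b * 3 ≤ ε := by
  have hb₀ : 0 < b := (by positivity : 0 < 4 / ε).trans_le hb
  have hexp : Real.exp (2 * B / b) ≤ 4 / 3 := by
    have hneg : 3 / 4 ≤ Real.exp (-(2 * B / b)) := by
      have : 2 * B / b ≤ 1 / 4 := by rw [div_le_iff₀ hb₀]; linarith
      linarith [Real.one_sub_le_exp_neg (2 * B / b)]
    rw [Real.exp_neg] at hneg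
    simpa using inv_anti₀ (by norm_num) hneg
  rw [div_mul_eq_mul_div, div_le_iff₀ hb₀]
  linarith [(div_le_iff₀' hε).1 hb]

theorem neg_mul_add_sq_mul_le {n p x ℓ : ℝ} {J m : ℕ} (hn : 0 < n) (hp : 0 < p) (hx : 0 < x)
    (hℓ : 0 < ℓ) (hJ : 2 * x ≤ 2 ^ J) (hm : 16 * p * ℓ ≤ m) :
    -(8 * p * x * ℓ / n * (n / (4 * x))) + (8 * p * x * ℓ / n) ^ 2 * (n ^ 2 / (m * 4 ^ J)) ≤
      -(p * ℓ) := by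
  have hm₀ : (0 : ℝ) < m := (by positivity : 0 < 16 * p * ℓ).trans_le hm
  have hlin : 8 * p * x * ℓ / n * (n / (4 * x)) = 2 * (p * ℓ) := by field_simp; norm_num
  have hquad : (8 * p * x * ℓ / n) ^ 2 * (n ^ 2 / (m * 4 ^ J)) ≤ p * ℓ := by
    have h4 : (4 : ℝ) ^ J = (2 ^ J) ^ 2 := by rw [← pow_mul, mul_comm, pow_mul]; norm_num
    calc (8 * p * x * ℓ / n) ^ 2 * (n ^ 2 / (m * 4 ^ J))
        = p * ℓ * (16 * p * ℓ * (2 * x) ^ 2) / (m * (2 ^ J) ^ 2) := by rw [h4]; field_simp; ring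
      _ ≤ p * ℓ * (m * (2 ^ J) ^ 2) / (m * (2 ^ J) ^ 2) := by gcongr
      _ = p * ℓ := mul_div_cancel_right₀ _ (by positivity)
  linarith

theorem exists_isEdgeDP_of_level_bounds {n J m : ℕ} [NeZero n] {c p x ℓ ε : ℝ} (hc : 0 < c)
    (hp : 0 < p) (hx : 0 < x) (hℓ : 0 < ℓ) (hε : 0 < ε) (hJ : 2 * x ≤ 2 ^ J)
    (hpm : 16 * p * ℓ ≤ m) (hcm : 32 * c * ℓ ≤ m) :
    ∃ A : RandQueryAlg n, A.IsEdgeDP ε ∧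
      A.ApproximatesNumComponents (n / x + 8 * c * ℓ / ε)
        (2 * Real.exp (-(p * ℓ)) + Real.exp (-(2 * c * ℓ))) ∧
      A.MakesAtMostQueries (J * (m * 4 ^ (J + 1))) := by
  have hn : (0 : ℝ) < n := by exact_mod_cast Nat.pos_of_ne_zero (NeZero.ne n)
  have hm₀ : (0 : ℝ) < m := (by positivity : 0 < 32 * c * ℓ).trans_le hcm
  set b := 4 / ε + n / (8 * c * x * ℓ) with hb
  have hbε : 4 / ε ≤ b := le_add_of_nonneg_right (by positivity)
  have hb₀ : 0 < b := by positivity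
  have hBb : 8 * (n / (m * 2 ^ J)) ≤ b :=
    calc 8 * (n / (m * 2 ^ J)) ≤ 8 * (n / (32 * c * ℓ * (2 * x))) := by gcongr
      _ = n / (8 * c * x * ℓ) := by field_simp; norm_num
      _ ≤ b := le_add_of_nonneg_left (by positivity)
  have hlB : 8 * p * x * ℓ / n * (n / (m * 2 ^ J)) ≤ 1 :=
    calc 8 * p * x * ℓ / n * (n / (m * 2 ^ J))
        ≤ 8 * p * x * ℓ / n * (n / (16 * p * ℓ * (2 * x))) := by gcongr
      _ ≤ 1 := by field_simp; norm_num
  obtain ⟨A, hprivate, haccurate, hqueries⟩ := exists_isEdgeDP_of_levels (n := n) (J := J) (m := m)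
    (l := 8 * p * x * ℓ / n) (r := n / (4 * x)) (t := 2 * c * ℓ * b) (by exact_mod_cast hm₀) hb₀
    (exp_two_mul_div_div_mul_three_le hε hbε hBb) (by positivity) hlB (by positivity)
  refine ⟨A, hprivate, haccurate.mono ?_ ?_, hqueries⟩
  · calc n / 2 ^ J + n / (4 * x) + 2 * c * ℓ * b
        ≤ n / (2 * x) + n / (4 * x) + 2 * c * ℓ * b := by gcongr
      _ = n / x + 8 * c * ℓ / ε := by rw [hb]; field_simp; ring
  · have hnoise : -(2 * c * ℓ * b) / b = -(2 * c * ℓ) := by field_simp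
    rw [hnoise]
    gcongr
    exact neg_mul_add_sq_mul_le hn hp hx hℓ hJ hpm

theorem level_cost_le {s ℓ x : ℝ} {J m : ℕ} (hs : 0 < s) (hℓ : Real.log 2 ≤ ℓ) (hx : 2 ≤ x)
    (hm : m ≤ s * ℓ + 1) (hJ : (2 : ℝ) ^ J ≤ 4 * x) :
    J * (m * 4 ^ (J + 1)) ≤ 320 * (s + 2) * (ℓ * x ^ 2 * Real.log x) := by
  have hlog2 : 0.69 < Real.log 2 := by linarith [Real.log_two_gt_d9]
  have hlogx : Real.log 2 ≤ Real.log x := Real.log_le_log (by norm_num) hx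
  have hJ_le : (J : ℝ) ≤ 5 * Real.log x := by
    have hpow : (2 : ℝ) ^ J ≤ x ^ 3 := by nlinarith [mul_le_mul hx hx (by norm_num) (by linarith)]
    have hlog := Real.log_le_log (by positivity) hpow
    rw [Real.log_pow, Real.log_pow] at hlog
    push_cast at hlog
    nlinarith [Nat.cast_nonneg (α := ℝ) J]
  have hm_le : m ≤ (s + 2) * ℓ := by linarith
  have hsq : (4 : ℝ) ^ (J + 1) ≤ 64 * x ^ 2 :=
    calc (4 : ℝ) ^ (J + 1) = 4 * (2 ^ J) ^ 2 := by
          rw [pow_succ', ← pow_mul, mul_comm J, pow_mul]; norm_num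
      _ ≤ 4 * (4 * x) ^ 2 := by gcongr
      _ = 64 * x ^ 2 := by ring
  have hℓ₀ : 0 < ℓ := by linarith
  have hlogx₀ : 0 < Real.log x := by linarith
  calc J * (m * 4 ^ (J + 1)) ≤ 5 * Real.log x * ((s + 2) * ℓ * (64 * x ^ 2)) := by gcongr
    _ = _ := by ring

theorem exists_isEdgeDP_of_two_le {n : ℕ} (hn : 2 ≤ n) {c p x ε : ℝ} (hc : 0 < c) (hp : 0 < p)
    (hx : 2 ≤ x) (hε : 0 < ε) :
    ∃ A : RandQueryAlg n, A.IsEdgeDP ε ∧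
      A.ApproximatesNumComponents (n / x + 8 * c * Real.log n / ε)
        (2 * Real.exp (-(p * Real.log n)) + Real.exp (-(2 * c * Real.log n))) ∧
      A.MakesAtMostQueries
        (320 * (16 * p + 32 * c + 2) * (Real.log n * x ^ 2 * Real.log x)) := by
  have : NeZero n := ⟨by omega⟩
  have hℓ : Real.log 2 ≤ Real.log n := Real.log_le_log (by norm_num) (by exact_mod_cast hn)
  have hℓ₀ : 0 < Real.log n := (Real.log_pos (by norm_num)).trans_le hℓ
  obtain ⟨J, hJ_le, hJ_lt⟩ := exists_nat_pow_near (x := 2 * x) (y := 2) (by linarith) (by norm_num)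
  set s := 16 * p + 32 * c with hs
  have hsm := Nat.le_ceil (s * Real.log n)
  obtain ⟨A, hprivate, haccurate, hqueries⟩ :=
    exists_isEdgeDP_of_level_bounds (n := n) (m := ⌈s * Real.log n⌉₊) hc hp (by linarith) hℓ₀ hε
      hJ_lt.le (hsm.trans' (by gcongr; rw [hs]; linarith))
      (hsm.trans' (by gcongr; rw [hs]; linarith))
  refine ⟨A, hprivate, haccurate, hqueries.mono (level_cost_le (by positivity) hℓ hx ?_ ?_)⟩
  · exact (Nat.ceil_lt_add_one (by positivity)).le
  · rw [pow_succ]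
    linarith

theorem exists_two_mul_exp_add_exp_le {c l₀ : ℝ} (hc : 0 < c) (hl₀ : 0 < l₀) :
    ∃ p : ℝ, 0 < p ∧ ∀ l, l₀ ≤ l →
      2 * Real.exp (-(p * l)) + Real.exp (-(2 * c * l)) ≤ Real.exp (-(c * l)) := by
  set q := 1 - Real.exp (-(c * l₀)) with hq
  have hq₀ : 0 < q := by
    rw [hq, sub_pos, Real.exp_lt_one_iff, neg_lt_zero]
    positivity
  have hq₁ : q < 1 := by
    rw [hq]
    linarith [Real.exp_pos (-(c * l₀))]
  set k := -Real.log (q / 2) / l₀ with hk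
  have hk₀ : 0 < k := div_pos (neg_pos.2 (Real.log_neg (by linarith) (by linarith))) hl₀
  refine ⟨c + k, by positivity, fun l hl => ?_⟩
  have hexpk : Real.exp (-(k * l)) ≤ q / 2 :=
    calc Real.exp (-(k * l)) ≤ Real.exp (-(k * l₀)) := by gcongr
      _ = q / 2 := by rw [hk, div_mul_cancel₀ _ hl₀.ne', neg_neg, Real.exp_log (by positivity)]
  have hexpc : Real.exp (-(c * l)) ≤ 1 - q := by
    rw [hq, sub_sub_cancel]
    gcongr
  calc 2 * Real.exp (-((c + k) * l)) + Real.exp (-(2 * c * l))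
      = Real.exp (-(c * l)) * (2 * Real.exp (-(k * l)) + Real.exp (-(c * l))) := by
        rw [mul_add, ← Real.exp_add, mul_left_comm, ← Real.exp_add]
        ring_nf
    _ ≤ Real.exp (-(c * l)) := mul_le_of_le_one_right (Real.exp_pos _).le (by linarith)

end Parameters

section Regimes

variable {n : ℕ} {ε t : ℝ}

theorem exists_isEdgeDP_makesAtMostQueries_zero (n : ℕ) (hε : 0 < ε) (ht : 0 ≤ t) :
    ∃ A : RandQueryAlg n, A.IsEdgeDP ε ∧
      A.ApproximatesNumComponents (n / 2 + t) (Real.exp (-(ε * t))) ∧ A.MakesAtMostQueries 0 := by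
  have h := RandQueryAlg.exists_isEdgeDP_of_deterministic (n := n) hε ht (q := 0)
    (tree := fun z => .output (n / 2 + z)) (val := fun _ => n / 2) (r := n / 2)
    (fun _ _ _ => rfl) (fun _ _ _ => le_rfl) (by simp) fun G => ?_
  · exact_mod_cast h
  · have hcard : (numComponents G : ℝ) ≤ n := by
      exact_mod_cast (numComponents_le_card G).trans_eq (Fintype.card_fin n)
    rw [abs_le]
    constructor <;> linarith [Nat.cast_nonneg (α := ℝ) (numComponents G)]

theorem exists_isEdgeDP_makesAtMostQueries_mul_self (n : ℕ) (hε : 0 < ε) (ht : 0 ≤ t) :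
    ∃ A : RandQueryAlg n, A.IsEdgeDP ε ∧
      A.ApproximatesNumComponents t (Real.exp (-(ε * t))) ∧ A.MakesAtMostQueries (n * n) := by
  have h := RandQueryAlg.exists_isEdgeDP_of_deterministic (n := n) hε ht (q := n * n)
    (val := fun G => numComponents G) (r := 0) (fun _ L z => QueryTree.run_exactTree L z)
    (fun _ L z => (QueryTree.queries_exactTree L z).le)
    (fun _ _ h => h.abs_numComponents_sub_le_one) (by simp)
  rwa [zero_add, Nat.cast_mul] at h

theorem mul_self_le_mul_sq_mul_log {C N ℓ x : ℝ} (hC : 10 ≤ C) (hℓ : Real.log 2 ≤ ℓ) (hx : 2 ≤ x)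
    (hN : 0 ≤ N) (hNx : N ≤ x) : N * N ≤ C * (ℓ * x ^ 2 * Real.log x) := by
  have hlogx : Real.log 2 ≤ Real.log x := Real.log_le_log two_pos hx
  have hlog2 : 0.69 < Real.log 2 := by linarith [Real.log_two_gt_d9]
  have hcoeff : 1 ≤ C * (ℓ * Real.log x) :=
    calc (1 : ℝ) ≤ 10 * (0.69 * 0.69) := by norm_num
      _ ≤ C * (ℓ * Real.log x) := by gcongr <;> linarith
  calc N * N ≤ x * x := by gcongr
    _ ≤ C * (ℓ * Real.log x) * (x * x) := le_mul_of_one_le_left (by positivity) hcoeff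
    _ = C * (ℓ * x ^ 2 * Real.log x) := by ring

theorem exists_isEdgeDP_of_pos (hn : 2 ≤ n) {c p x : ℝ} (hc : 0 < c) (hp : 0 < p) (hε : 0 < ε)
    (hx : 0 < x)
    (hfail : 2 * Real.exp (-(p * Real.log n)) + Real.exp (-(2 * c * Real.log n)) ≤
      Real.exp (-(c * Real.log n))) :
    ∃ A : RandQueryAlg n, A.IsEdgeDP ε ∧
      A.ApproximatesNumComponents
        (n / x + 8 * c * Real.log n / ε * (n / x) + 2 * c * Real.log n / ε)
        (Real.exp (-(c * Real.log n))) ∧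
      A.MakesAtMostQueries
        (320 * (16 * p + 32 * c + 2) * (Real.log n * x ^ 2 * max 0 (Real.log x))) := by
  have hlogn : Real.log 2 ≤ Real.log n := Real.log_le_log two_pos (by exact_mod_cast hn)
  have hlogn₀ : 0 < Real.log n := (Real.log_pos one_lt_two).trans_le hlogn
  have hexp : Real.exp (-(ε * (2 * c * Real.log n / ε))) ≤ Real.exp (-(c * Real.log n)) := by
    rw [mul_div_cancel₀ _ hε.ne']
    gcongr
    linarith
  have hnoise : 0 ≤ 8 * c * Real.log n / ε * (n / x) := by positivity
  have hbias : 0 ≤ n / x := by positivity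
  rcases lt_or_ge x 2 with hx2 | hx2
  · obtain ⟨A, hprivate, haccurate, hqueries⟩ := exists_isEdgeDP_makesAtMostQueries_zero n hε
      (by positivity : 0 ≤ 2 * c * Real.log n / ε)
    have hhalf : (n : ℝ) / 2 ≤ n / x := by gcongr
    exact ⟨A, hprivate, haccurate.mono (by linarith) hexp, hqueries.mono (by positivity)⟩
  have hlogx : Real.log 2 ≤ Real.log x := Real.log_le_log two_pos hx2
  rw [max_eq_right (by linarith [Real.log_two_gt_d9])]
  rcases le_or_gt x n with hxn | hxn
  · obtain ⟨A, hprivate, haccurate, hqueries⟩ := exists_isEdgeDP_of_two_le hn hc hp hx2 hε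
    refine ⟨A, hprivate, haccurate.mono ?_ hfail, hqueries⟩
    have hscale : 8 * c * Real.log n / ε ≤ 8 * c * Real.log n / ε * (n / x) :=
      le_mul_of_one_le_right (by positivity) ((one_le_div hx).2 hxn)
    have : 0 ≤ 2 * c * Real.log n / ε := by positivity
    linarith
  · obtain ⟨A, hprivate, haccurate, hqueries⟩ := exists_isEdgeDP_makesAtMostQueries_mul_self n hε
      (by positivity : 0 ≤ 2 * c * Real.log n / ε)
    refine ⟨A, hprivate, haccurate.mono (by linarith) hexp, hqueries.mono ?_⟩
    exact mul_self_le_mul_sq_mul_log (by linarith) hlogn hx2 (Nat.cast_nonneg n) hxn.le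

end Regimes

theorem mainTheorem6_general (c : ℝ) (hc : 0 < c) :
    ∃ C : ℝ, 0 < C ∧
      ∀ ε κ : ℝ, 0 < ε → 0 < κ →
        ∃ A : (n : ℕ) → RandQueryAlg n,
          (∀ n, (A n).IsEdgeDP ε) ∧
          (∀ n, 2 ≤ n → (A n).ApproximatesNumComponents
            (κ * n * (8 * c / ε + 1 / Real.log n) + 2 * c * Real.log n / ε) (1 / (n : ℝ) ^ c)) ∧
          (∀ n, 2 ≤ n → (A n).MakesAtMostQueries
            (C * (Real.log n ^ 3 / κ ^ 2 * max 0 (Real.log (Real.log n / κ))))) := by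
  obtain ⟨p, hp, hfail⟩ := exists_two_mul_exp_add_exp_le hc (Real.log_pos one_lt_two)
  set C := 320 * (16 * p + 32 * c + 2) with hC
  refine ⟨C, by positivity, fun ε κ hε hκ => ?_⟩
  have hexists (n : ℕ) : ∃ A : RandQueryAlg n, A.IsEdgeDP ε ∧ (2 ≤ n →
      A.ApproximatesNumComponents
        (κ * n * (8 * c / ε + 1 / Real.log n) + 2 * c * Real.log n / ε) (1 / (n : ℝ) ^ c) ∧
      A.MakesAtMostQueries
        (C * (Real.log n ^ 3 / κ ^ 2 * max 0 (Real.log (Real.log n / κ))))) := by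
    by_cases hn : 2 ≤ n
    · have hlog : 0 < Real.log n := Real.log_pos (by exact_mod_cast hn)
      obtain ⟨A, hprivate, haccurate, hqueries⟩ :=
        exists_isEdgeDP_of_pos hn hc hp hε (div_pos hlog hκ)
          (hfail _ (Real.log_le_log two_pos (by exact_mod_cast hn)))
      refine ⟨A, hprivate, fun _ => ⟨haccurate.mono (le_of_eq ?_) (le_of_eq ?_),
        hqueries.mono (le_of_eq ?_)⟩⟩
      · field_simp
        ring
      · rw [Real.rpow_def_of_pos (by positivity), one_div, ← Real.exp_neg, mul_comm]
      · rw [hC]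
        ring
    · obtain ⟨A, hprivate, -⟩ := exists_isEdgeDP_makesAtMostQueries_zero n hε le_rfl
      exact ⟨A, hprivate, fun h => absurd h hn⟩
  choose A hprivate h using hexists
  exact ⟨A, hprivate, fun n hn => (h n hn).1, fun n hn => (h n hn).2⟩

theorem mainTheorem6 (c : ℝ) (hc : 0 < c) :
    ∃ C : ℝ, 0 < C ∧
      ∀ (K : ℕ) (ε κ : ℝ), 0 < K → 0 < ε → 0 < κ →
        ∃ A : (n : ℕ) → RandQueryAlg n,
          -- privacy
          (∀ n : ℕ, (A n).IsEdgeDP ε) ∧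
          -- accuracy
          (∀ n : ℕ, 2 ≤ n → ∀ (G : SimpleGraph (Fin n)) (L : AdjList G),
            1 - 1 / (n : ℝ) ^ c - 1 / ((n : ℝ) ^ (c - 1) * (Real.exp ε - 1) / K + 1) ≤
              ((A n).law L).real
                (Set.Icc ((numComponents G : ℝ) - ccError K c ε κ n)
                  ((numComponents G : ℝ) + ccError K c ε κ n))) ∧
          -- number of queries, for every outcome of the coins
          (∀ n : ℕ, 2 ≤ n → ∀ (G : SimpleGraph (Fin n)) (L : AdjList G) (ω : (A n).Coins),
            (((A n).tree ω).queries L : ℝ) ≤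
              C * (Real.log n ^ 3 / κ ^ 2 * max 0 (Real.log (Real.log n / κ)))) := by
  obtain ⟨C, hC, h⟩ := mainTheorem6_general c hc
  refine ⟨C, hC, fun K ε κ _ hε hκ => ?_⟩
  obtain ⟨A, hprivate, haccurate, hqueries⟩ := h ε κ hε hκ
  refine ⟨A, hprivate, fun n hn G L => ?_, hqueries⟩
  have hexp : 0 ≤ Real.exp ε - 1 := by linarith [Real.add_one_le_exp ε]
  rw [sub_sub]
  exact (haccurate n hn).mono (le_add_of_nonneg_right (by positivity))
    (le_add_of_nonneg_right (by positivity)) G L
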